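/- Let $N\ge 1$, $s\in(0,1)$, $1<p<2$ with $ps<N$ and $\frac{2N}{N+2s}\le p$, and put $p_s^*=\frac{pN}{N-ps}$, $d\nu=\frac{dx\,dy}{|x-y|^{N+ps}}$. For a bounded open set $\Omega\subset\mathbb R^N$ let $D_\Omega=(\mathbb R^N\times\mathbb R^N)\setminus(\Omega^c\times\Omega^c)$, let $W^{s,p}_0(\Omega)$ be the completion of $C_0^\infty(\Omega)$ with respect to the norm $\|v\|_{L^p}+\big(\iint_{D_\Omega}|v(x)-v(y)|^p\,d\nu\big)^{1/p}$ (functions being extended by $0$ outside $\Omega$), and let $W^{-s,p'}(\Omega)$ be its dual, $p'=\frac p{p-1}$. For $T>0$ and $u_0\in L^2(\Omega)$, a nonnegative energy solution on $(0,T)$ of $$u_t+(-\Delta)^s_p u=0\ \text{ in }\Omega\times(0,T),\qquad u=0\ \text{ in }(\mathbb R^N\setminus\Omega)\times(0,T),\qquad u(\cdot,0)=u_0\ \text{ in }\Omega$$ is a function $u\ge 0$, $u\in L^p(0,T;W^{s,p}_0(\Omega))\cap C([0,T];L^2(\Omega))$, vanishing outside $\Omega$, whose distributional derivative satisfies $u_t\in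 L^{p'}(0,T;W^{-s,p'}(\Omega))$, such that $u(\cdot,t)\to u_0$ in $L^2(\Omega)$ as $t\to0^+$ and, for all $v\in L^p(0,T;W^{s,p}_0(\Omega))$, $$\int_0^T\langle u_t,v\rangle\,dt+\frac12\int_0^T\!\!\iint_{D_\Omega}|u(x,t)-u(y,t)|^{p-2}(u(x,t)-u(y,t))(v(x,t)-v(y,t))\,d\nu\,dt=0.$$ There are constants $S>0$ with $$\iint_{\mathbb R^N\times\mathbb R^N}|v(x)-v(y)|^p\,d\nu\ \ge\ S\Big(\int_{\mathbb R^N}|v|^{p_s^*}\,dx\Big)^{p/p_s^*}\qquad\text{for all }v\in C_0^\infty(\mathbb R^N).$$ Let $S$ be any such constant. Then there is a finite time $T^*=T^*(|\Omega|,\|u_0\|_2)\ge0$, depending (for given $N,s,p,S$) only on $|\Omega|$ and $\|u_0\|_{L^2(\Omega)}$, with $$T^*\le\frac{2}{(2-p)S}\,\|u_0\|_2^{2-p}\,|\Omega|^{\frac p2-\frac p{p^*_s}},$$ such that for every bounded open $\Omega$ and every $u_0\in L^2(\Omega)$: every nonnegative energy solution $u$ on $(0,T)$, $T>0$, satisfies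 $u(\cdot,t)=0$ a.e. for all $t\in[T^*,T]$. In particular, if $u$ is a nonnegative energy solution on $(0,T)$ for every $T>0$, then $u(\cdot,t)=0$ a.e. for all $t\ge T^*$. -/

import Mathlib

open MeasureTheory Filter Set
open scoped ENNReal Topology ContDiff

noncomputable section

namespace FracPLap

/-- Euclidean space `ℝ^N`. -/
abbrev E (N : ℕ) : Type := EuclideanSpace ℝ (Fin N)

instance instFactOneLe (p : ℝ) [h : Fact (1 < p)] : Fact ((1 : ℝ≥0∞) ≤ ENNReal.ofReal p) :=
  ⟨by rw [← ENNReal.ofReal_one]; exact ENNReal.ofReal_le_ofReal h.out.le⟩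

/-- The measure `dν = dx dy / |x - y|^(N + p s)` on `ℝ^N × ℝ^N`. -/
def nu (N : ℕ) (s p : ℝ) : Measure (E N × E N) :=
  (volume : Measure (E N × E N)).withDensity
    fun z => ENNReal.ofReal (‖z.1 - z.2‖ ^ (-((N : ℝ) + p * s)))

/-- `D_Ω = (ℝ^N × ℝ^N) \ (Ωᶜ × Ωᶜ)`. -/
def DOmega {N : ℕ} (Ω : Set (E N)) : Set (E N × E N) := (Ωᶜ ×ˢ Ωᶜ)ᶜ

/-- `φ ∈ C_0^∞(Ω)`, as a function on the whole space. -/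
structure IsTest {X : Type*} [NormedAddCommGroup X] [NormedSpace ℝ X]
    (Ω : Set X) (φ : X → ℝ) : Prop where
  smooth : ContDiff ℝ ∞ φ
  compact : HasCompactSupport φ
  support : tsupport φ ⊆ Ω

/-- The ambient Banach space `L^p(ℝ^N) × L^p(D_Ω, dν)`, which receives a function `v` as the pair
`(v, v(x) - v(y))`. The norm of such a pair is the maximum of `‖v‖_p` and of the Gagliardo
seminorm `(∬_{D_Ω} |v(x) - v(y)|^p dν)^(1/p)`, and so is equivalent to their sum. -/
abbrev Ambient {N : ℕ} (s p : ℝ) (Ω : Set (E N)) : Type :=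
  Lp ℝ (ENNReal.ofReal p) (volume : Measure (E N)) ×
    Lp ℝ (ENNReal.ofReal p) ((nu N s p).restrict (DOmega Ω))

/-- The copy of `C_0^∞(Ω)` in the ambient space. -/
def testSubmodule {N : ℕ} (s p : ℝ) (Ω : Set (E N)) : Submodule ℝ (Ambient s p Ω) where
  carrier := {w | ∃ φ : E N → ℝ, IsTest Ω φ ∧ w.1 =ᵐ[volume] φ ∧
    w.2 =ᵐ[(nu N s p).restrict (DOmega Ω)] fun z => φ z.1 - φ z.2}
  zero_mem' := by
    refine ⟨0, ⟨contDiff_const, HasCompactSupport.zero, by simp [tsupport]⟩,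
      Lp.coeFn_zero _ _ _, ?_⟩
    filter_upwards [Lp.coeFn_zero ℝ (ENNReal.ofReal p) ((nu N s p).restrict (DOmega Ω))] with z hz
    simpa using hz
  add_mem' := by
    rintro a b ⟨φ, hφ, h1, h2⟩ ⟨ψ, hψ, k1, k2⟩
    refine ⟨φ + ψ, ⟨hφ.smooth.add hψ.smooth, hφ.compact.add hψ.compact,
      (tsupport_add φ ψ).trans (union_subset hφ.support hψ.support)⟩, ?_, ?_⟩
    · exact (Lp.coeFn_add a.1 b.1).trans (h1.add k1)
    · filter_upwards [Lp.coeFn_add a.2 b.2, h2, k2] with z hz e1 e2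
      simp only [Prod.snd_add, hz, Pi.add_apply, e1, e2]
      ring
  smul_mem' := by
    rintro c a ⟨φ, hφ, h1, h2⟩
    have hs : Function.support (c • φ) ⊆ Function.support φ := by
      intro x hx
      simp only [Function.mem_support, Pi.smul_apply, smul_eq_mul] at hx ⊢
      exact right_ne_zero_of_mul hx
    refine ⟨c • φ, ⟨contDiff_const.smul hφ.smooth, hφ.compact.mono hs,
      (closure_mono hs).trans hφ.support⟩, ?_, ?_⟩
    · filter_upwards [Lp.coeFn_smul c a.1, h1] with x hx e1
      simp only [Prod.smul_fst, hx, Pi.smul_apply, e1]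
    · filter_upwards [Lp.coeFn_smul c a.2, h2] with z hz e1
      simp only [Prod.smul_snd, hz, Pi.smul_apply, e1, smul_eq_mul]
      ring

/-- `W_0^{s,p}(Ω)`: the completion of `C_0^∞(Ω)`, realised as a closure in a Banach space. -/
def W0 {N : ℕ} (s p : ℝ) [Fact (1 < p)] (Ω : Set (E N)) : Type :=
  ↥(testSubmodule s p Ω).topologicalClosure

instance {N : ℕ} (s p : ℝ) [Fact (1 < p)] (Ω : Set (E N)) : NormedAddCommGroup (W0 s p Ω) :=
  inferInstanceAs (NormedAddCommGroup ↥(testSubmodule s p Ω).topologicalClosure)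

instance {N : ℕ} (s p : ℝ) [Fact (1 < p)] (Ω : Set (E N)) : NormedSpace ℝ (W0 s p Ω) :=
  inferInstanceAs (NormedSpace ℝ ↥(testSubmodule s p Ω).topologicalClosure)

instance {N : ℕ} (s p : ℝ) [Fact (1 < p)] (Ω : Set (E N)) : CompleteSpace (W0 s p Ω) :=
  inferInstanceAs (CompleteSpace ↥(testSubmodule s p Ω).topologicalClosure)

/-- The inclusion of `W_0^{s,p}(Ω)` in the ambient Banach space. -/
def W0.incl {N : ℕ} (s p : ℝ) [Fact (1 < p)] (Ω : Set (E N)) : W0 s p Ω →L[ℝ] Ambient s p Ω :=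
  (testSubmodule s p Ω).topologicalClosure.subtypeL

/-- The function on `ℝ^N` (vanishing a.e. outside `Ω`) underlying an element of `W_0^{s,p}(Ω)`. -/
def W0.fn {N : ℕ} {s p : ℝ} [Fact (1 < p)] {Ω : Set (E N)} (v : W0 s p Ω) : E N → ℝ :=
  (W0.incl s p Ω v).1

/-- `⟨(-Δ)^s_p w, v⟩ = 1/2 ∬_{D_Ω} |w(x)-w(y)|^(p-2) (w(x)-w(y)) (v(x)-v(y)) dν`. -/
def pForm {N : ℕ} (s p : ℝ) (Ω : Set (E N)) (w v : E N → ℝ) : ℝ :=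
  (1 / 2) * ∫ z in DOmega Ω,
    |w z.1 - w z.2| ^ (p - 2) * (w z.1 - w z.2) * (v z.1 - v z.2) ∂(nu N s p)

/-- `ξ` is the derivative of `u` in time on `(0,T)`, in the sense of distributions with values in
the dual of `W_0^{s,p}(Ω)`; tested with `φ(t) w(x)`, `φ ∈ C_0^∞(0,T)`, `w ∈ C_0^∞(Ω)`. -/
def HasTimeDeriv {N : ℕ} (s p : ℝ) [Fact (1 < p)] (Ω : Set (E N)) (T : ℝ)
    (u : ℝ → E N → ℝ) (ξ : ℝ → StrongDual ℝ (W0 s p Ω)) : Prop :=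
  ∀ φ : ℝ → ℝ, IsTest (Ioo 0 T) φ →
  ∀ (w : W0 s p Ω) (g : E N → ℝ), IsTest Ω g → w.fn =ᵐ[volume] g →
    ∫ t in Ioo 0 T, φ t * ξ t w = -∫ t in Ioo 0 T, deriv φ t * ∫ x in Ω, u t x * g x

/-- `u` (with `u t x` for `u(x,t)`) is an energy solution of
`u_t + (-Δ)^s_p u = f` in `Ω × (0,T)`, `u ≥ 0`, `u = 0` outside `Ω`, `u(·,0) = u₀`. -/
structure IsEnergySolution {N : ℕ} (s p : ℝ) [Fact (1 < p)] (Ω : Set (E N)) (T : ℝ)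
    (f : ℝ → StrongDual ℝ (W0 s p Ω)) (u₀ : E N → ℝ) (u : ℝ → E N → ℝ) : Prop where
  /-- `f ∈ L^{p'}(0,T; W^{-s,p'}(Ω))` -/
  memLp_source : MemLp f (ENNReal.ofReal (p / (p - 1))) (volume.restrict (Ioo 0 T))
  /-- `u₀ ∈ L²(Ω)` -/
  memLp_initial : MemLp u₀ 2 (volume.restrict Ω)
  /-- `u = 0` outside `Ω` -/
  exterior : ∀ t ∈ Icc 0 T, ∀ᵐ x ∂(volume.restrict Ωᶜ), u t x = 0
  /-- `u ≥ 0` -/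
  nonneg : ∀ t ∈ Ioo 0 T, ∀ᵐ x, 0 ≤ u t x
  /-- `u(·,t) ∈ L²(Ω)` -/
  memLp_two : ∀ t ∈ Icc 0 T, MemLp (u t) 2 (volume.restrict Ω)
  /-- `u ∈ C([0,T]; L²(Ω))` -/
  continuous_two : ∀ t₀ ∈ Icc 0 T,
    Tendsto (fun t => eLpNorm (u t - u t₀) 2 (volume.restrict Ω)) (𝓝[Icc 0 T] t₀) (𝓝 0)
  /-- `u(·,t) → u₀` in `L²(Ω)` as `t → 0` -/
  initial : Tendsto (fun t => eLpNorm (u t - u₀) 2 (volume.restrict Ω)) (𝓝[>] 0) (𝓝 0)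
  /-- `u ∈ L^p(0,T; W_0^{s,p}(Ω))` -/
  memLp_W0 : ∃ û : ℝ → W0 s p Ω, MemLp û (ENNReal.ofReal p) (volume.restrict (Ioo 0 T)) ∧
    ∀ᵐ t ∂(volume.restrict (Ioo 0 T)), (û t).fn =ᵐ[volume] u t
  /-- `u_t ∈ L^{p'}(0,T; W^{-s,p'}(Ω))`, and the equation holds against every
  `v ∈ L^p(0,T; W_0^{s,p}(Ω))` -/
  equation : ∃ ξ : ℝ → StrongDual ℝ (W0 s p Ω),
    MemLp ξ (ENNReal.ofReal (p / (p - 1))) (volume.restrict (Ioo 0 T)) ∧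
    HasTimeDeriv s p Ω T u ξ ∧
    ∀ v : ℝ → W0 s p Ω, MemLp v (ENNReal.ofReal p) (volume.restrict (Ioo 0 T)) →
      (∫ t in Ioo 0 T, ξ t (v t)) + ∫ t in Ioo 0 T, pForm s p Ω (u t) (v t).fn
        = ∫ t in Ioo 0 T, f t (v t)

/-- The critical exponent `p_s^* = p N / (N - p s)`. -/
def critExp (N : ℕ) (s p : ℝ) : ℝ := p * N / (N - p * s)

/-- `S > 0` is a constant for which the fractional Sobolev inequality
`∬ |v(x)-v(y)|^p dν ≥ S (∫ |v|^{p_s^*})^{p/p_s^*}` holds for all `v ∈ C_0^∞(ℝ^N)`. -/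
def IsSobolevConst (N : ℕ) (s p S : ℝ) : Prop :=
  0 < S ∧ ∀ v : E N → ℝ, IsTest univ v →
    ENNReal.ofReal S * (∫⁻ x, ‖v x‖ₑ ^ critExp N s p) ^ (p / critExp N s p)
      ≤ ∫⁻ z, ‖v z.1 - v z.2‖ₑ ^ p ∂(nu N s p)

/-- The `L²(Ω)` norm. -/
def norm2 {N : ℕ} (Ω : Set (E N)) (g : E N → ℝ) : ℝ :=
  (eLpNorm g 2 (volume.restrict Ω)).toReal

end FracPLap

end

/-! Testing the equation with `u` itself gives d/dt ‖u‖₂² = -[u]^p, where [u]^p is the Gagliardo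
energy over `DOmega Ω`; the factor 1/2 in the form cancels the 2 from differentiating the square.
The condition 2N/(N+2s) ≤ p says exactly that p_s^* ≥ 2, so the Sobolev inequality followed by
Hölder on Ω yields [u]^p ≥ c ‖u‖₂^p with c = S |Ω|^(-(p/2 - p/p_s^*)). Hence y = ‖u‖₂² satisfies y'
≤ -c y^(p/2). As p/2 < 1, with θ = 1 - p/2 the power y^θ falls at rate at least cθ while y > 0, so y
vanishes by the time y(0)^θ/(cθ), which is the stated bound (`eq_zero_of_integral_inequality`).

The delicate point is the chain rule, because u_t lives only in a dual space. The inequality ‖u(b)‖²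
- ‖u(a)‖² ≤ 2∫⟨u_t,u⟩ is enough (`energy_inequality`). It comes from backward difference quotients:
(u(t) - u(t-h))/h is a Steklov average of u_t, these averages converge by continuity of translations
in L^{p'}, and polarisation has the favourable sign.

That some Sobolev constant exists (`exists_isSobolevConst`) is proved by comparing v(x) with its
average on a ball, optimising the radius at each x, and integrating in x. -/

namespace FracPLap

/-! ### The fractional Sobolev inequality -/

/-- Optimising `x ≤ a r^s h^{1/p} + b r^{-N/q} M` over the radius `r`. -/
theorem rpow_le_of_forall_radius {a b h M s p q N x : ℝ} (hN : 0 < N) (hp : 0 < p) (hq : 0 < q)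
    (hrel : 1 / q = 1 / p - s / N) (ha : 0 ≤ a) (hb : 0 ≤ b) (hh : 0 ≤ h) (hM : 0 < M)
    (hx : 0 ≤ x)
    (H : ∀ r : ℝ, 0 < r → x ≤ a * r ^ s * h ^ (1 / p) + b * r ^ (-(N / q)) * M) :
    x ^ q ≤ (a + b) ^ q * M ^ (q - p) * h := by
  -- For h = 0 the best radius would be infinite, so h is replaced by k > h and k decreases to h at
  -- the end.
  have key : ∀ k : ℝ, h < k → x ^ q ≤ (a + b) ^ q * M ^ (q - p) * k := by
    intro k hk
    have hk0 : 0 < k := hh.trans_lt hk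
    obtain ⟨m, rfl⟩ : ∃ m, Real.exp m = M := ⟨_, Real.exp_log hM⟩
    obtain ⟨l, rfl⟩ : ∃ l, Real.exp l = k := ⟨_, Real.exp_log hk0⟩
    -- This is r = (M^p/k)^(1/N), which makes r^s k^(1/p) and r^(-N/q) M both equal to M^(1-p/q)
    -- k^(1/q). In logarithms the exponent identities become linear.
    have h1 := H (Real.exp ((p * m - l) / N)) (Real.exp_pos _)
    have h2 : h ^ (1 / p) ≤ Real.exp l ^ (1 / p) :=
      Real.rpow_le_rpow hh hk.le (by positivity)
    have hs : s = N / p - N / q := by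
      have : s / N = 1 / p - 1 / q := by linarith
      rw [div_eq_iff hN.ne'] at this
      rw [this]; ring
    have h3 : x ≤ (a + b) * Real.exp ((1 - p / q) * m + l / q) := by
      refine h1.trans ?_
      have e1 : Real.exp ((p * m - l) / N) ^ s * Real.exp l ^ (1 / p)
          = Real.exp ((1 - p / q) * m + l / q) := by
        rw [← Real.exp_mul, ← Real.exp_mul, ← Real.exp_add, hs]
        congr 1
        field_simp
        ring
      have e2 : Real.exp ((p * m - l) / N) ^ (-(N / q)) * Real.exp m
          = Real.exp ((1 - p / q) * m + l / q) := by
        rw [← Real.exp_mul, ← Real.exp_add]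
        congr 1
        field_simp
        ring
      rw [mul_assoc, mul_assoc, e2, add_mul]
      gcongr
      rw [← e1]
      gcongr
    calc x ^ q ≤ ((a + b) * Real.exp ((1 - p / q) * m + l / q)) ^ q :=
          Real.rpow_le_rpow hx h3 hq.le
      _ = (a + b) ^ q * Real.exp m ^ (q - p) * Real.exp l := by
          rw [Real.mul_rpow (by positivity) (by positivity), mul_assoc]
          congr 1
          rw [← Real.exp_mul, ← Real.exp_mul, ← Real.exp_add]
          congr 1
          field_simp
  have hc : Tendsto (fun k : ℝ => (a + b) ^ q * M ^ (q - p) * k) (𝓝[>] h)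
      (𝓝 ((a + b) ^ q * M ^ (q - p) * h)) :=
    ((continuous_const.mul continuous_id).tendsto h).mono_left nhdsWithin_le_nhds
  exact ge_of_tendsto hc (eventually_mem_nhdsWithin.mono fun k hk => key k hk)

/-- The average of `|f|` over a set is controlled by the `L^q` norm. -/
theorem setLIntegral_enorm_le {X : Type*} [MeasurableSpace X] {μ : Measure X} {f : X → ℝ}
    (hf : Measurable f) {q : ℝ} (hq : 1 ≤ q) (B : Set X) :
    ∫⁻ y in B, ‖f y‖ₑ ∂μ ≤ (∫⁻ y in B, ‖f y‖ₑ ^ q ∂μ) ^ (1 / q) * μ B ^ (1 - 1 / q) := by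
  have := eLpNorm'_le_eLpNorm'_mul_rpow_measure_univ (μ := μ.restrict B) (f := f) one_pos hq
    hf.aestronglyMeasurable
  simpa [eLpNorm'] using this

theorem measurable_kernel (N : ℕ) (s p : ℝ) :
    Measurable fun z : E N × E N => ENNReal.ofReal (‖z.1 - z.2‖ ^ (-((N : ℝ) + p * s))) := by
  fun_prop

theorem critExp_pos {N : ℕ} {s p : ℝ} (hp : 0 < p) (hs : 0 < s) (hps : p * s < N) :
    0 < critExp N s p := by
  have : 0 < p * s := by positivity
  exact div_pos (mul_pos hp (by linarith)) (by linarith)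

theorem one_div_critExp {N : ℕ} {s p : ℝ} (hp : 0 < p) (hs : 0 < s) (hps : p * s < N) :
    1 / critExp N s p = 1 / p - s / N := by
  have h1 : 0 < p * s := by positivity
  have h2 : (N : ℝ) ≠ 0 := by linarith
  have h3 : (N : ℝ) - p * s ≠ 0 := by linarith
  unfold critExp
  field_simp

theorem lt_critExp {N : ℕ} {s p : ℝ} (hp : 0 < p) (hs : 0 < s) (hps : p * s < N) :
    p < critExp N s p := by
  have h1 : 0 < p * s := by positivity
  unfold critExp
  rw [lt_div_iff₀ (by linarith)]
  nlinarith

/-- The pointwise bound behind the fractional Sobolev inequality. -/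
theorem enorm_le_radius {N : ℕ} {s p : ℝ} (hp : 1 < p) (hs : 0 < s) (hps : p * s < N)
    {v : E N → ℝ} (hv : Measurable v) (x : E N) {r : ℝ} (hr : 0 < r) :
    volume (Metric.ball x r) * ‖v x‖ₑ ≤
      (ENNReal.ofReal (r ^ ((N : ℝ) + p * s)) * ∫⁻ y, ENNReal.ofReal
        (‖x - y‖ ^ (-((N : ℝ) + p * s))) * ‖v x - v y‖ₑ ^ p) ^ (1 / p)
          * volume (Metric.ball x r) ^ (1 - 1 / p)
      + (∫⁻ y, ‖v y‖ₑ ^ critExp N s p) ^ (1 / critExp N s p)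
          * volume (Metric.ball x r) ^ (1 - 1 / critExp N s p) := by
  have hp0 : 0 < p := by linarith
  have h1 : 0 < p * s := by positivity
  have hN : 0 < N := by
    have : (0 : ℝ) < N := by linarith
    exact_mod_cast this
  have : Nonempty (Fin N) := ⟨⟨0, hN⟩⟩
  have hq1 : 1 ≤ critExp N s p := (hp.trans (lt_critExp hp0 hs hps)).le
  set B := Metric.ball x r
  calc volume B * ‖v x‖ₑ = ∫⁻ y in B, ‖v x‖ₑ := by
        rw [setLIntegral_const, mul_comm]
    _ ≤ ∫⁻ y in B, (‖v x - v y‖ₑ + ‖v y‖ₑ) := by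
        refine lintegral_mono fun y => ?_
        simpa using enorm_add_le (v x - v y) (v y)
    _ = (∫⁻ y in B, ‖v x - v y‖ₑ) + ∫⁻ y in B, ‖v y‖ₑ := lintegral_add_right _ hv.enorm
    _ ≤ _ := by
        refine add_le_add ((setLIntegral_enorm_le (f := fun y => v x - v y)
          (by fun_prop) hp.le B).trans ?_) ((setLIntegral_enorm_le hv hq1 B).trans ?_)
        · gcongr
          rw [← lintegral_const_mul' _ _ ENNReal.ofReal_ne_top]
          refine le_trans (lintegral_mono_ae ?_) (setLIntegral_le_lintegral B _)
          -- On the ball the inserted factor r^(N+ps) ‖x-y‖^(-(N+ps)) is at least 1. The point y =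
          -- x, where the real power takes the default value 0, is a null set.
          filter_upwards [ae_restrict_mem measurableSet_ball,
            ae_restrict_of_ae (Measure.ae_ne volume x)] with y hy hne
          rw [← mul_assoc, ← ENNReal.ofReal_mul (by positivity)]
          refine le_mul_of_one_le_left (by positivity) ?_
          have hd : 0 < ‖x - y‖ := norm_pos_iff.2 (sub_ne_zero.2 (Ne.symm hne))
          have hd' : ‖x - y‖ ≤ r := by
            rw [← dist_eq_norm, dist_comm]; exact (Metric.mem_ball.1 hy).le
          rw [ENNReal.one_le_ofReal, Real.rpow_neg hd.le, ← div_eq_mul_inv,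
            one_le_div (by positivity)]
          exact Real.rpow_le_rpow hd.le hd' (by linarith)
        · gcongr
          exact Measure.restrict_le_self

theorem lintegral_nu_eq {N : ℕ} (s p : ℝ) {v : E N → ℝ} (hv : Measurable v) :
    ∫⁻ z, ‖v z.1 - v z.2‖ₑ ^ p ∂(nu N s p) = ∫⁻ x, ∫⁻ y, ENNReal.ofReal
        (‖x - y‖ ^ (-((N : ℝ) + p * s))) * ‖v x - v y‖ₑ ^ p := by
  have hm : Measurable fun z : E N × E N => ‖v z.1 - v z.2‖ₑ ^ p := by fun_prop
  rw [nu, lintegral_withDensity_eq_lintegral_mul _ (measurable_kernel N s p) hm,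
    Measure.volume_eq_prod, lintegral_prod]
  · rfl
  · exact ((measurable_kernel N s p).mul hm).aemeasurable

/-- The fractional Sobolev inequality. -/
theorem exists_isSobolevConst {N : ℕ} {s p : ℝ} (hp : 1 < p) (hs : 0 < s) (hps : p * s < N) :
    ∃ S : ℝ, IsSobolevConst N s p S := by
  have hp0 : 0 < p := by linarith
  have h1 : 0 < p * s := by positivity
  have hN' : (0 : ℝ) < N := by linarith
  have hN : 0 < N := by exact_mod_cast hN'
  have : Nonempty (Fin N) := ⟨⟨0, hN⟩⟩
  have hq0 := critExp_pos hp0 hs hps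
  have hpq := lt_critExp hp0 hs hps
  have hrel := one_div_critExp hp0 hs hps
  set q := critExp N s p with hq
  set κ : ℝ := volume.real (Metric.ball (0 : E N) 1) with hκ
  have hκ0 : 0 < κ := ENNReal.toReal_pos (Metric.measure_ball_pos _ _ one_pos).ne'
    measure_ball_lt_top.ne
  set C : ℝ := (κ ^ (-(1 / p)) + κ ^ (-(1 / q))) ^ q with hC
  have hC0 : 0 < C := by positivity
  refine ⟨C⁻¹, inv_pos.2 hC0, fun v hv => ?_⟩
  have hvm : Measurable v := hv.smooth.continuous.measurable
  rw [lintegral_nu_eq s p hvm]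
  set H : E N → ℝ≥0∞ := fun x => ∫⁻ y, ENNReal.ofReal
        (‖x - y‖ ^ (-((N : ℝ) + p * s))) * ‖v x - v y‖ₑ ^ p with hH
  set I := ∫⁻ x, ‖v x‖ₑ ^ q with hI
  have hIfin : I ≠ ⊤ := by
    have hmem : MemLp v (ENNReal.ofReal q) volume :=
      hv.smooth.continuous.memLp_of_hasCompactSupport hv.compact
    have := lintegral_rpow_enorm_lt_top_of_eLpNorm_lt_top (by simpa using hq0)
      ENNReal.ofReal_ne_top hmem.2
    rw [ENNReal.toReal_ofReal hq0.le] at this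
    exact this.ne
  rcases eq_or_ne I 0 with hI0 | hI0
  · rw [hI0, ENNReal.zero_rpow_of_pos (by positivity), mul_zero]
    exact zero_le
  set M : ℝ := (I ^ (1 / q)).toReal with hM
  have hIq : I ^ (1 / q) = ENNReal.ofReal M :=
    (ENNReal.ofReal_toReal (ENNReal.rpow_ne_top_of_nonneg (by positivity) hIfin)).symm
  have hM0 : 0 < M := by
    refine ENNReal.toReal_pos ?_ (ENNReal.rpow_ne_top_of_nonneg (by positivity) hIfin)
    simp [ENNReal.rpow_eq_zero_iff, hI0, hIfin]
  have hpt : ∀ x, ‖v x‖ₑ ^ q ≤ ENNReal.ofReal (C * M ^ (q - p)) * H x := by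
    intro x
    rcases eq_or_ne (H x) ⊤ with hHx | hHx
    · rw [hHx, ENNReal.mul_top]
      · exact le_top
      · simp only [ne_eq, ENNReal.ofReal_eq_zero, not_le]; positivity
    have := rpow_le_of_forall_radius (a := κ ^ (-(1 / p))) (b := κ ^ (-(1 / q)))
      (h := (H x).toReal) (x := |v x|) hN' hp0 hq0 hrel (by positivity) (by positivity)
      ENNReal.toReal_nonneg hM0 (abs_nonneg _) ?_
    · rw [← Real.enorm_abs, Real.enorm_of_nonneg (abs_nonneg _),
        ENNReal.ofReal_rpow_of_nonneg (abs_nonneg _) hq0.le, ← ENNReal.ofReal_toReal hHx,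
        ← ENNReal.ofReal_mul (by positivity)]
      exact ENNReal.ofReal_le_ofReal this
    intro r hr
    have hb := enorm_le_radius hp hs hps hvm x hr
    set m : ℝ := r ^ N * κ with hm
    have hm0 : 0 < m := by positivity
    have hvol : volume (Metric.ball x r) = ENNReal.ofReal m := by
      rw [Measure.addHaar_ball _ _ hr.le, finrank_euclideanSpace_fin, hm,
        ENNReal.ofReal_mul (by positivity), hκ, measureReal_def,
        ENNReal.ofReal_toReal measure_ball_lt_top.ne]
    change _ ≤ (_ * H x) ^ _ * _ + I ^ _ * _ at hb
    rw [hvol, hIq, ← ENNReal.ofReal_toReal hHx, ← Real.enorm_abs,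
      Real.enorm_of_nonneg (abs_nonneg _), ← ENNReal.ofReal_mul (by positivity),
      ← ENNReal.ofReal_mul (by positivity),
      ENNReal.ofReal_rpow_of_nonneg (by positivity) (by positivity),
      ENNReal.ofReal_rpow_of_pos hm0, ENNReal.ofReal_rpow_of_pos hm0,
      ← ENNReal.ofReal_mul (by positivity), ← ENNReal.ofReal_mul (by positivity),
      ← ENNReal.ofReal_add (by positivity) (by positivity),
      ENNReal.ofReal_le_ofReal_iff (by positivity)] at hb
    rw [← mul_le_mul_iff_right₀ hm0]
    refine hb.trans (le_of_eq ?_)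
    have e0 : r ^ N = r ^ (N : ℝ) := (Real.rpow_natCast r N).symm
    have e1 : ∀ t : ℝ, m ^ (1 - t) = m * (κ ^ (-t) * r ^ (-(N * t))) := by
      intro t
      rw [sub_eq_add_neg, Real.rpow_add hm0, Real.rpow_one, hm,
        Real.mul_rpow (by positivity) hκ0.le, e0, ← Real.rpow_mul hr.le]
      ring_nf
    rw [e1, e1, Real.mul_rpow (by positivity) ENNReal.toReal_nonneg, ← Real.rpow_mul hr.le]
    have e2 : r ^ s = r ^ ((N + p * s) * (1 / p)) * r ^ (-(N * (1 / p))) := by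
      rw [← Real.rpow_add hr]; congr 1; field_simp; ring
    rw [e2, show (N : ℝ) / q = N * (1 / q) by ring]
    ring
  -- Integrating the pointwise bound gives M^q ≤ C M^(q-p) ∬. Since 0 < M < ∞, by compact support
  -- and the case split on `I`, dividing by M^(q-p) leaves the claim for M^p = I^(p/q).
  have hinteg : I ≤ ENNReal.ofReal (C * M ^ (q - p)) * ∫⁻ x, H x := by
    rw [← lintegral_const_mul' _ _ ENNReal.ofReal_ne_top]
    exact lintegral_mono hpt
  have hIM : I = ENNReal.ofReal (M ^ q) := by
    rw [← ENNReal.ofReal_rpow_of_pos hM0, ← hIq, ← ENNReal.rpow_mul, one_div_mul_cancel hq0.ne',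
      ENNReal.rpow_one]
  have hIp : I ^ (p / q) = ENNReal.ofReal (M ^ p) := by
    rw [← ENNReal.ofReal_rpow_of_pos hM0, ← hIq, ← ENNReal.rpow_mul]
    congr 1; ring
  rw [hIp, ← ENNReal.ofReal_mul (by positivity)]
  rcases eq_or_ne (∫⁻ x, H x) ⊤ with hT | hT
  · rw [hT]; exact le_top
  rw [hIM, ← ENNReal.ofReal_toReal hT, ← ENNReal.ofReal_mul (by positivity),
    ENNReal.ofReal_le_ofReal_iff (by positivity)] at hinteg
  rw [← ENNReal.ofReal_toReal hT]
  refine ENNReal.ofReal_le_ofReal ?_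
  rw [inv_mul_le_iff₀ hC0]
  have e : M ^ q = M ^ (q - p) * M ^ p := by rw [← Real.rpow_add hM0]; congr 1; ring
  rw [e] at hinteg
  have : 0 < M ^ (q - p) := by positivity
  refine le_of_mul_le_mul_left (hinteg.trans (le_of_eq ?_)) this
  ring

/-! ### Scalar weak derivatives in time -/

theorem deriv_smoothTransition_of_nonpos {x : ℝ} (hx : x ≤ 0) :
    deriv Real.smoothTransition x = 0 :=
  -- Every x ≤ 0 is a global minimum of the transition, which also covers the junction x = 0.
  IsLocalMin.deriv_eq_zero <| Eventually.of_forall fun y => by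
    simpa [Real.smoothTransition.zero_of_nonpos hx] using Real.smoothTransition.nonneg y

theorem deriv_smoothTransition_of_one_le {x : ℝ} (hx : 1 ≤ x) :
    deriv Real.smoothTransition x = 0 :=
  IsLocalMax.deriv_eq_zero <| Eventually.of_forall fun y => by
    simpa [Real.smoothTransition.one_of_one_le hx] using Real.smoothTransition.le_one y

theorem contDiff_smoothTransition : ContDiff ℝ ∞ Real.smoothTransition :=
  Real.smoothTransition.contDiff

theorem hasDerivAt_smoothTransition_scaled (c ε t : ℝ) :
    HasDerivAt (fun t => Real.smoothTransition ((t - c) / ε))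
      (ε⁻¹ * deriv Real.smoothTransition ((t - c) / ε)) t := by
  have h1 : HasDerivAt Real.smoothTransition (deriv Real.smoothTransition ((t - c) / ε))
      ((t - c) / ε) :=
    ((contDiff_smoothTransition.differentiable (by simp)) _).hasDerivAt
  have h2 : HasDerivAt (fun t : ℝ => (t - c) / ε) (1 / ε) t :=
    ((hasDerivAt_id t).sub_const c).div_const ε
  rw [mul_comm, ← one_div]
  exact h1.comp t h2

/-- Testing against the derivative of a smoothed step at `c` recovers the value at `c`. -/
theorem tendsto_integral_deriv_step {g : ℝ → ℝ} (hg : Continuous g) {c T : ℝ} (hc0 : 0 < c)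
    (hcT : c < T) :
    Tendsto (fun ε : ℝ => ∫ t in Ioo 0 T,
      (ε⁻¹ * deriv Real.smoothTransition ((t - c) / ε)) * g t) (𝓝[>] 0) (𝓝 (g c)) := by
  have hd : Continuous (deriv Real.smoothTransition) :=
    contDiff_smoothTransition.continuous_deriv (by simp)
  -- Substituting t = c + εx turns the integral into one that is continuous in ε up to ε = 0, where
  -- it equals g(c).
  have hF : Continuous fun ε : ℝ =>
      ∫ x in (0 : ℝ)..1, deriv Real.smoothTransition x * g (c + ε * x) := by
    refine intervalIntegral.continuous_parametric_intervalIntegral_of_continuous' ?_ 0 1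
    fun_prop
  have h0 : (∫ x in (0 : ℝ)..1, deriv Real.smoothTransition x * g (c + 0 * x)) = g c := by
    simp only [zero_mul, add_zero]
    rw [intervalIntegral.integral_mul_const, intervalIntegral.integral_deriv_eq_sub
      (fun x _ => contDiff_smoothTransition.differentiable (by simp) x)
      (hd.intervalIntegrable _ _)]
    simp
  have hlim := (hF.tendsto 0).mono_left (nhdsWithin_le_nhds (s := Ioi (0 : ℝ)))
  rw [h0] at hlim
  refine hlim.congr' ?_
  filter_upwards [Ioo_mem_nhdsGT (sub_pos.2 hcT)] with ε hε
  have hε0 : 0 < ε := hε.1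
  have hsub : Ioc c (c + ε) ⊆ Ioo 0 T := fun t ht =>
    ⟨hc0.trans ht.1, by have := ht.2; have := hε.2; linarith⟩
  rw [setIntegral_eq_of_subset_of_forall_sdiff_eq_zero measurableSet_Ioo hsub,
    ← intervalIntegral.integral_of_le (by linarith)]
  · have := intervalIntegral.smul_integral_comp_add_mul (a := 0) (b := 1)
      (fun t => (ε⁻¹ * deriv Real.smoothTransition ((t - c) / ε)) * g t) ε c
    simp only [mul_zero, add_zero, mul_one] at this
    rw [← this, smul_eq_mul, ← intervalIntegral.integral_const_mul]
    refine intervalIntegral.integral_congr fun x _ => ?_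
    simp only [add_sub_cancel_left, mul_div_cancel_left₀ _ hε0.ne']
    field_simp
  · rintro t ⟨ht, ht'⟩
    have : deriv Real.smoothTransition ((t - c) / ε) = 0 := by
      rcases le_or_gt t c with h | h
      · exact deriv_smoothTransition_of_nonpos (div_nonpos_of_nonpos_of_nonneg (by linarith) hε0.le)
      · refine deriv_smoothTransition_of_one_le ((one_le_div hε0).2 ?_)
        by_contra hcon
        exact ht' ⟨h, by linarith⟩
    simp [this]

/-- The test function is a smoothed step up at `a` minus one at `b`. As ε → 0 it tends to the
indicator of (a,b], while its derivative picks out g(a) - g(b). Its support lies in [a, b+ε], whence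
the strict inequalities at both ends. -/
theorem sub_eq_integral_of_weakDeriv_Ioo {T : ℝ} {g ψ : ℝ → ℝ} (hg : Continuous g)
    (hψ : IntegrableOn ψ (Ioo 0 T))
    (H : ∀ φ : ℝ → ℝ, IsTest (Ioo 0 T) φ →
      ∫ t in Ioo 0 T, φ t * ψ t = -∫ t in Ioo 0 T, deriv φ t * g t)
    {a b : ℝ} (ha : 0 < a) (hab : a ≤ b) (hb : b < T) :
    g b - g a = ∫ t in a..b, ψ t := by
  set Φ := Real.smoothTransition
  have hd : Continuous (deriv Φ) := contDiff_smoothTransition.continuous_deriv (by simp)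
  have htest : ∀ᶠ ε in 𝓝[>] (0 : ℝ),
      IsTest (Ioo 0 T) (fun t => Φ ((t - a) / ε) - Φ ((t - b) / ε)) := by
    filter_upwards [Ioo_mem_nhdsGT (sub_pos.2 hb)] with ε hε
    have hε0 : 0 < ε := hε.1
    have hsupp : tsupport (fun t => Φ ((t - a) / ε) - Φ ((t - b) / ε)) ⊆ Icc a (b + ε) := by
      refine closure_minimal (fun t ht => ?_) isClosed_Icc
      by_contra hcon
      refine ht ?_
      rcases lt_or_ge t a with h | h
      · have e1 : Φ ((t - a) / ε) = 0 := Real.smoothTransition.zero_of_nonpos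
          (div_nonpos_of_nonpos_of_nonneg (by linarith) hε0.le)
        have e2 : Φ ((t - b) / ε) = 0 := Real.smoothTransition.zero_of_nonpos
          (div_nonpos_of_nonpos_of_nonneg (by linarith) hε0.le)
        simp [e1, e2]
      · have h' : b + ε < t := by
          by_contra h''
          exact hcon ⟨h, not_lt.1 h''⟩
        have e1 : Φ ((t - a) / ε) = 1 := Real.smoothTransition.one_of_one_le
          ((one_le_div hε0).2 (by linarith))
        have e2 : Φ ((t - b) / ε) = 1 := Real.smoothTransition.one_of_one_le
          ((one_le_div hε0).2 (by linarith))
        simp [e1, e2]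
    refine ⟨?_, HasCompactSupport.of_support_subset_isCompact isCompact_Icc
      ((subset_tsupport _).trans hsupp), hsupp.trans fun t ht =>
        ⟨ha.trans_le ht.1, ht.2.trans_lt (by have := hε.2; linarith)⟩⟩
    exact (contDiff_smoothTransition.comp ((contDiff_id.sub contDiff_const).div_const ε)).sub
      (contDiff_smoothTransition.comp ((contDiff_id.sub contDiff_const).div_const ε))
  have hlim2 := (tendsto_integral_deriv_step hg ha (hab.trans_lt hb)).sub
    (tendsto_integral_deriv_step hg (ha.trans_le hab) hb)
  have hlim1 : Tendsto (fun ε : ℝ => ∫ t in Ioo 0 T,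
      (Φ ((t - a) / ε) - Φ ((t - b) / ε)) * ψ t) (𝓝[>] 0)
      (𝓝 (∫ t in Ioo 0 T, (Ioc a b).indicator ψ t)) := by
    refine tendsto_integral_filter_of_dominated_convergence (fun t => |ψ t|) ?_ ?_ hψ.abs ?_
    · refine Eventually.of_forall fun ε => AEStronglyMeasurable.mul ?_ hψ.1
      have : Continuous fun t : ℝ => Φ ((t - a) / ε) - Φ ((t - b) / ε) := by
        have := Real.smoothTransition.continuous
        fun_prop
      exact this.aestronglyMeasurable
    · refine Eventually.of_forall fun ε => Eventually.of_forall fun t => ?_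
      rw [norm_mul, Real.norm_eq_abs, Real.norm_eq_abs]
      refine mul_le_of_le_one_left (abs_nonneg _) (abs_le.2 ⟨?_, ?_⟩)
      · linarith [Real.smoothTransition.nonneg ((t - a) / ε),
          Real.smoothTransition.le_one ((t - b) / ε)]
      · linarith [Real.smoothTransition.nonneg ((t - b) / ε),
          Real.smoothTransition.le_one ((t - a) / ε)]
    · refine Eventually.of_forall fun t => ?_
      have hone : ∀ c, c < t → ∀ᶠ ε in 𝓝[>] (0 : ℝ), Φ ((t - c) / ε) = 1 := by
        intro c hc
        filter_upwards [Ioo_mem_nhdsGT (sub_pos.2 hc)] with ε hε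
        exact Real.smoothTransition.one_of_one_le ((one_le_div hε.1).2 hε.2.le)
      have hzero : ∀ c, t ≤ c → ∀ᶠ ε in 𝓝[>] (0 : ℝ), Φ ((t - c) / ε) = 0 := by
        intro c hc
        filter_upwards [self_mem_nhdsWithin] with ε hε
        exact Real.smoothTransition.zero_of_nonpos
          (div_nonpos_of_nonpos_of_nonneg (by linarith) (le_of_lt hε))
      refine tendsto_const_nhds.congr' ?_
      rcases le_or_gt t a with h | h
      · filter_upwards [hzero a h, hzero b (h.trans hab)] with ε e1 e2
        rw [indicator_of_notMem (fun h' => absurd h'.1 (not_lt.2 h)), e1, e2]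
        simp
      rcases le_or_gt t b with h' | h'
      · filter_upwards [hone a h, hzero b h'] with ε e1 e2
        rw [indicator_of_mem (show t ∈ Ioc a b from ⟨h, h'⟩), e1, e2]
        simp
      · filter_upwards [hone a h, hone b h'] with ε e1 e2
        rw [indicator_of_notMem (fun h'' => absurd h''.2 (not_le.2 h')), e1, e2]
        simp
  have hsub : Ioc a b ⊆ Ioo 0 T := fun t ht => ⟨ha.trans ht.1, ht.2.trans_lt hb⟩
  have e1 : ∫ t in Ioo 0 T, (Ioc a b).indicator ψ t = ∫ t in a..b, ψ t := by
    rw [setIntegral_indicator measurableSet_Ioc, inter_eq_right.2 hsub,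
      intervalIntegral.integral_of_le hab]
  rw [e1] at hlim1
  have hlim3 : Tendsto (fun ε : ℝ => ∫ t in Ioo 0 T,
      (Φ ((t - a) / ε) - Φ ((t - b) / ε)) * ψ t) (𝓝[>] 0) (𝓝 (-(g a - g b))) := by
    refine hlim2.neg.congr' ?_
    filter_upwards [htest] with ε hε
    rw [H _ hε]
    congr 1
    have hcont : ∀ c, IntegrableOn (fun t => ε⁻¹ * deriv Φ ((t - c) / ε) * g t) (Ioo 0 T) := by
      intro c
      have : Continuous fun t => ε⁻¹ * deriv Φ ((t - c) / ε) * g t := by fun_prop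
      exact (this.integrableOn_Icc (a := 0) (b := T)).mono_set Ioo_subset_Icc_self
    rw [← integral_sub (hcont a) (hcont b)]
    refine integral_congr_ae (Eventually.of_forall fun t => ?_)
    have := ((hasDerivAt_smoothTransition_scaled a ε t).sub
      (hasDerivAt_smoothTransition_scaled b ε t)).deriv
    change deriv (fun t => Φ ((t - a) / ε) - Φ ((t - b) / ε)) t = _ at this
    simp only [this]
    ring
  rw [← tendsto_nhds_unique hlim3 hlim1]
  ring

/-- A continuous function with an integrable weak derivative on `(0,T)` is its primitive on
`[0,T]`. -/
theorem sub_eq_integral_of_weakDeriv {T : ℝ} {g ψ : ℝ → ℝ} (hg : Continuous g)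
    (hψ : IntegrableOn ψ (Ioo 0 T))
    (H : ∀ φ : ℝ → ℝ, IsTest (Ioo 0 T) φ →
      ∫ t in Ioo 0 T, φ t * ψ t = -∫ t in Ioo 0 T, deriv φ t * g t)
    {a b : ℝ} (ha : 0 ≤ a) (hab : a ≤ b) (hb : b ≤ T) :
    g b - g a = ∫ t in a..b, ψ t := by
  rcases eq_or_lt_of_le hab with rfl | hab'
  · simp
  have hT : 0 < T := by linarith
  have hψ' : IntegrableOn ψ (uIcc 0 T) := by
    rw [uIcc_of_le hT.le, integrableOn_Icc_iff_integrableOn_Ioo]; exact hψ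
  have hinteg : ∀ {c d}, c ∈ Icc 0 T → d ∈ Icc 0 T → IntervalIntegrable ψ volume c d := by
    intro c d hc hd
    rw [uIcc_of_le hT.le] at hψ'
    exact (hψ'.mono_set (uIcc_subset_Icc hc hd)).intervalIntegrable
  have hcont := intervalIntegral.continuousOn_primitive_interval hψ'
  rw [uIcc_of_le hT.le] at hcont
  set c := T / 2
  have hc : c ∈ Ioo 0 T := ⟨by positivity, by simp only [c]; linarith⟩
  -- Minus its primitive, g is constant on the open interval; continuity carries this to the
  -- endpoints.
  have hG : EqOn (fun t => g t - ∫ τ in (0 : ℝ)..t, ψ τ)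
      (fun _ => g c - ∫ τ in (0 : ℝ)..c, ψ τ) (Ioo 0 T) := by
    intro t ht
    have h0 : (0 : ℝ) ∈ Icc 0 T := ⟨le_rfl, hT.le⟩
    rcases le_total c t with h | h
    · have := sub_eq_integral_of_weakDeriv_Ioo hg hψ H hc.1 h ht.2
      rw [← intervalIntegral.integral_interval_sub_left (hinteg h0 (Ioo_subset_Icc_self ht))
        (hinteg h0 (Ioo_subset_Icc_self hc))] at this
      simp only
      linarith
    · have := sub_eq_integral_of_weakDeriv_Ioo hg hψ H ht.1 h hc.2
      rw [← intervalIntegral.integral_interval_sub_left (hinteg h0 (Ioo_subset_Icc_self hc))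
        (hinteg h0 (Ioo_subset_Icc_self ht))] at this
      simp only
      linarith
  have hG' := hG.of_subset_closure (hg.continuousOn.sub hcont) continuousOn_const
    Ioo_subset_Icc_self (by rw [closure_Ioo hT.ne])
  have ha' : a ∈ Icc 0 T := ⟨ha, by linarith⟩
  have hb' : b ∈ Icc 0 T := ⟨by linarith, hb⟩
  have h0 : (0 : ℝ) ∈ Icc 0 T := ⟨le_rfl, hT.le⟩
  have e1 := hG' ha'
  have e2 := hG' hb'
  simp only at e1 e2
  rw [← intervalIntegral.integral_interval_sub_left (hinteg h0 hb') (hinteg h0 ha')]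
  linarith

/-! ### Translations and Steklov averages -/

theorem tendsto_eLpNorm_translate {X : Type*} [NormedAddCommGroup X] {q : ℝ≥0∞} [Fact (1 ≤ q)]
    (hq : q ≠ ⊤) {F : ℝ → X} (hF : MemLp F q volume) :
    Tendsto (fun σ : ℝ => eLpNorm (fun t => F (t - σ) - F t) q volume) (𝓝 0) (𝓝 0) := by
  have : Fact (q ≠ ⊤) := ⟨hq⟩
  set f := hF.toLp F
  have hc : Continuous fun σ : ℝ => DomAddAct.mk (-σ) +ᵥ f := by
    have h : Continuous fun σ : ℝ => DomAddAct.mk (-σ) :=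
      DomAddAct.continuous_mk.comp continuous_neg
    exact h.vadd continuous_const
  have h0 := tendsto_iff_edist_tendsto_0.1 (hc.tendsto 0)
  refine h0.congr fun σ => ?_
  have e0 : DomAddAct.mk (-(0 : ℝ)) +ᵥ f = f := by
    rw [neg_zero]; exact zero_vadd _ f
  rw [e0, Lp.edist_def]
  refine eLpNorm_congr_ae ?_
  have hqmp : MeasurePreserving (fun t : ℝ => t - σ) volume volume :=
    measurePreserving_sub_right volume σ
  have h1 := DomAddAct.vadd_Lp_ae_eq (DomAddAct.mk (-σ)) f
  have h2 := hqmp.quasiMeasurePreserving.ae_eq_comp hF.coeFn_toLp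
  filter_upwards [h1, h2, hF.coeFn_toLp] with t e1 e2 e3
  simp only [Pi.sub_apply, e1, Equiv.symm_apply_apply, vadd_eq_add]
  rw [← sub_eq_neg_add]
  simp only [Function.comp_apply] at e2
  rw [e2, ← e3]

section Steklov

variable {V : Type*} [NormedAddCommGroup V] [NormedSpace ℝ V]

theorem integrable_dual_pairing {X : Type*} [MeasurableSpace X] {μ : Measure X} {q r : ℝ≥0∞}
    [q.HolderConjugate r] {F : X → StrongDual ℝ V} (hF : MemLp F q μ) {w : X → V}
    (hw : MemLp w r μ) : Integrable (fun t => F t (w t)) μ := by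
  rw [← memLp_one_iff_integrable]
  refine MemLp.of_bilin (fun (a : StrongDual ℝ V) b => a b) 1 hF hw
    ((ContinuousLinearMap.apply ℝ ℝ).flip.aestronglyMeasurable_comp₂ hF.1 hw.1)
    (Eventually.of_forall fun t => ?_)
  rw [one_mul]
  exact (F t).le_opNNNorm (w t)

/-- The error of the Steklov average is the mean over σ ∈ (0,h] of F(t-σ) - F(t). Tonelli exchanges
t and σ, and Hölder in t for each fixed σ reduces everything to the translation modulus `ε`. Strong
measurability of `F` gives joint measurability in (t,σ). -/
theorem lintegral_enorm_steklov_sub_le {q r : ℝ≥0∞} [q.HolderConjugate r]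
    {F : ℝ → StrongDual ℝ V} (hFm : StronglyMeasurable F) (hF : LocallyIntegrable F volume)
    {w : ℝ → V} (hw : AEStronglyMeasurable w volume) {h : ℝ} (hh : 0 < h) {ε : ℝ≥0∞}
    (hε : ∀ σ ∈ Ioc 0 h, eLpNorm (fun t => F (t - σ) - F t) q volume ≤ ε) :
    ∫⁻ t, ‖h⁻¹ * (∫ τ in t - h..t, F τ) (w t) - F t (w t)‖ₑ ≤ ε * eLpNorm w r volume := by
  have hii : ∀ c d, IntervalIntegrable F volume c d := fun c d =>
    (hF.integrableOn_isCompact isCompact_uIcc).intervalIntegrable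
  have hcomp : ∀ t c d : ℝ, IntervalIntegrable (fun σ => F (t - σ)) volume c d := fun t c d => by
    simpa using (hii (t - c) (t - d)).comp_sub_left t
  have hpt : ∀ t, ‖h⁻¹ * (∫ τ in t - h..t, F τ) (w t) - F t (w t)‖ₑ ≤
      ENNReal.ofReal h⁻¹ * ∫⁻ σ in Ioc 0 h, ‖F (t - σ) - F t‖ₑ * ‖w t‖ₑ := by
    intro t
    have e1 : h⁻¹ * (∫ τ in t - h..t, F τ) (w t) - F t (w t)
        = h⁻¹ * (∫ σ in Ioc 0 h, (F (t - σ) - F t)) (w t) := by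
      rw [← intervalIntegral.integral_of_le hh.le, intervalIntegral.integral_sub (hcomp t 0 h)
        intervalIntegrable_const, intervalIntegral.integral_comp_sub_left]
      simp only [sub_zero, intervalIntegral.integral_const, sub_apply, smul_apply, smul_eq_mul]
      field_simp
    rw [e1, enorm_mul, Real.enorm_of_nonneg (inv_nonneg.2 hh.le)]
    gcongr
    calc _ ≤ ‖∫ σ in Ioc 0 h, (F (t - σ) - F t)‖ₑ * ‖w t‖ₑ := ContinuousLinearMap.le_opENorm _ _
      _ ≤ (∫⁻ σ in Ioc 0 h, ‖F (t - σ) - F t‖ₑ) * ‖w t‖ₑ := by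
          gcongr
          exact enorm_integral_le_lintegral_enorm _
      _ = _ := (lintegral_mul_const' _ _ enorm_ne_top).symm
  have hm : AEMeasurable (Function.uncurry fun t σ : ℝ => ‖F (t - σ) - F t‖ₑ * ‖w t‖ₑ)
      (volume.prod (volume.restrict (Ioc 0 h))) := by
    refine AEMeasurable.mul (StronglyMeasurable.enorm ?_).aemeasurable
      (hw.enorm.comp_fst)
    exact (hFm.comp_measurable (measurable_fst.sub measurable_snd)).sub
      (hFm.comp_measurable measurable_fst)
  calc _ ≤ ∫⁻ t, ENNReal.ofReal h⁻¹ * ∫⁻ σ in Ioc 0 h, ‖F (t - σ) - F t‖ₑ * ‖w t‖ₑ :=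
        lintegral_mono hpt
    _ = ENNReal.ofReal h⁻¹ * ∫⁻ σ in Ioc 0 h, ∫⁻ t, ‖F (t - σ) - F t‖ₑ * ‖w t‖ₑ := by
        rw [lintegral_const_mul' _ _ ENNReal.ofReal_ne_top, lintegral_lintegral_swap hm]
    _ ≤ ENNReal.ofReal h⁻¹ * ∫⁻ σ in Ioc 0 h, ε * eLpNorm w r volume := by
        gcongr ENNReal.ofReal h⁻¹ * ?_
        refine setLIntegral_mono' measurableSet_Ioc fun σ hσ => ?_
        have hFs : AEStronglyMeasurable (fun t => F (t - σ) - F t) volume :=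
          ((hFm.comp_measurable (measurable_id.sub_const σ)).sub hFm).aestronglyMeasurable
        have := eLpNorm_le_eLpNorm_mul_eLpNorm_of_nnnorm (p := q) (q := r) (r := 1) hFs hw
          (fun a b => ‖a‖ * ‖b‖) 1 (Eventually.of_forall fun t => by simp [nnnorm_mul])
        rw [eLpNorm_one_eq_lintegral_enorm] at this
        simp only [enorm_mul, enorm_norm, ENNReal.coe_one, one_mul] at this
        refine this.trans ?_
        gcongr
        exact hε σ hσ
    _ = ε * eLpNorm w r volume := by
        rw [setLIntegral_const, Real.volume_Ioc, sub_zero, mul_comm (ε * _), ← mul_assoc,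
          ← ENNReal.ofReal_mul (inv_nonneg.2 hh.le), inv_mul_cancel₀ hh.ne', ENNReal.ofReal_one,
          one_mul]

/-- Steklov averages of `F ∈ L^q(V')`, paired with `w ∈ L^r(V)`, converge. -/
theorem tendsto_integral_steklov {q r : ℝ≥0∞} [Fact (1 ≤ q)] (hq : q ≠ ⊤) [q.HolderConjugate r]
    {F : ℝ → StrongDual ℝ V} (hFm : StronglyMeasurable F) (hF : MemLp F q volume)
    {w : ℝ → V} (hw : MemLp w r volume) :
    (∀ᶠ h in 𝓝[>] (0 : ℝ), Integrable fun t => h⁻¹ * (∫ τ in t - h..t, F τ) (w t)) ∧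
    Tendsto (fun h : ℝ => ∫ t, h⁻¹ * (∫ τ in t - h..t, F τ) (w t)) (𝓝[>] 0)
      (𝓝 (∫ t, F t (w t))) := by
  have hFl : LocallyIntegrable F volume := hF.locallyIntegrable Fact.out
  have hii : ∀ c d, IntervalIntegrable F volume c d := fun c d =>
    (hFl.integrableOn_isCompact isCompact_uIcc).intervalIntegrable
  have hev : ∀ ε : ℝ≥0∞, 0 < ε → ∀ᶠ h in 𝓝[>] (0 : ℝ),
      ∀ σ ∈ Ioc 0 h, eLpNorm (fun t => F (t - σ) - F t) q volume ≤ ε := by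
    intro ε hε
    obtain ⟨δ, hδ, hball⟩ := Metric.eventually_nhds_iff.1
      (ENNReal.tendsto_nhds_zero.1 (tendsto_eLpNorm_translate hq hF) ε hε)
    filter_upwards [Ioo_mem_nhdsGT hδ] with h hh σ hσ
    refine hball ?_
    rw [Real.dist_eq, sub_zero, abs_of_pos hσ.1]
    exact hσ.2.trans_lt hh.2
  have hFw : Integrable (fun t => F t (w t)) volume := integrable_dual_pairing hF hw
  have hmeas : ∀ h : ℝ, AEStronglyMeasurable
      (fun t => h⁻¹ * (∫ τ in t - h..t, F τ) (w t)) volume := by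
    intro h
    have hP : Continuous fun t => ∫ τ in (0 : ℝ)..t, F τ :=
      intervalIntegral.continuous_primitive hii 0
    have hA : Continuous fun t => ∫ τ in t - h..t, F τ := by
      have : (fun t => ∫ τ in t - h..t, F τ)
          = fun t => (∫ τ in (0 : ℝ)..t, F τ) - ∫ τ in (0 : ℝ)..(t - h), F τ := by
        funext t
        rw [intervalIntegral.integral_interval_sub_left (hii _ _) (hii _ _)]
      rw [this]
      exact hP.sub (hP.comp (continuous_id.sub continuous_const))
    exact ((ContinuousLinearMap.apply ℝ ℝ).flip.aestronglyMeasurable_comp₂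
      hA.aestronglyMeasurable hw.1).const_mul _
  have hinteg : ∀ᶠ h in 𝓝[>] (0 : ℝ),
      Integrable fun t => h⁻¹ * (∫ τ in t - h..t, F τ) (w t) := by
    filter_upwards [hev 1 one_pos, self_mem_nhdsWithin] with h hh hh0
    have hle := lintegral_enorm_steklov_sub_le (r := r) hFm hFl hw.1 hh0 hh
    have : Integrable (fun t => h⁻¹ * (∫ τ in t - h..t, F τ) (w t) - F t (w t)) volume :=
      ⟨(hmeas h).sub hFw.1, hle.trans_lt (by rw [one_mul]; exact hw.2)⟩
    exact (this.add hFw).congr (Eventually.of_forall fun t => by simp)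
  refine ⟨hinteg, ?_⟩
  rw [tendsto_iff_edist_tendsto_0, ENNReal.tendsto_nhds_zero]
  intro ε hε
  obtain ⟨n, hn, hnε⟩ := ENNReal.exists_nnreal_pos_mul_lt hw.2.ne hε.ne'
  filter_upwards [hev n (by exact_mod_cast hn), self_mem_nhdsWithin, hinteg] with h hh hh0 hi
  rw [edist_eq_enorm_sub, ← integral_sub hi hFw]
  exact (enorm_integral_le_lintegral_enorm _).trans
    ((lintegral_enorm_steklov_sub_le (r := r) hFm hFl hw.1 hh0 hh).trans hnε.le)

end Steklov

/-! ### The energy inequality for a derivative in the dual -/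

section Energy

variable {V : Type*} [NormedAddCommGroup V] [NormedSpace ℝ V]
  {H : Type*} [NormedAddCommGroup H] [InnerProductSpace ℝ H]

/-- A weak time derivative tested on a dense set is a Bochner primitive in the dual. -/
theorem inner_sub_eq_integral_apply {T : ℝ} {J : V →L[ℝ] H} {U : ℝ → H} (hU : Continuous U)
    {ξ : ℝ → StrongDual ℝ V} (hξ : IntegrableOn ξ (Ioo 0 T)) {D : Set V} (hD : Dense D)
    (hweak : ∀ w ∈ D, ∀ φ : ℝ → ℝ, IsTest (Ioo 0 T) φ →
      ∫ t in Ioo 0 T, φ t * ξ t w = -∫ t in Ioo 0 T, deriv φ t * inner ℝ (U t) (J w))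
    {a b : ℝ} (ha : 0 ≤ a) (hab : a ≤ b) (hb : b ≤ T) (w : V) :
    inner ℝ (U b - U a) (J w) = (∫ t in a..b, ξ t) w := by
  have hsub : Ioo a b ⊆ Ioo 0 T := Ioo_subset_Ioo ha hb
  have hξ' : IntegrableOn ξ (Ioc a b) :=
    (hξ.mono_set hsub).congr_set_ae Ioo_ae_eq_Ioc.symm
  have hL : Continuous fun w : V => (inner ℝ (U b - U a) (J w) : ℝ) :=
    continuous_const.inner J.continuous
  have hR : Continuous fun w : V => (∫ t in a..b, ξ t) w := (∫ t in a..b, ξ t).continuous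
  refine congrFun (hL.ext_on hD hR fun w hw => ?_) w
  simp only
  rw [intervalIntegral.integral_of_le hab, ContinuousLinearMap.integral_apply hξ',
    ← intervalIntegral.integral_of_le hab,
    ← sub_eq_integral_of_weakDeriv (g := fun t => inner ℝ (U t) (J w)) (ψ := fun t => ξ t w)
      (hU.inner continuous_const) ((ContinuousLinearMap.apply ℝ ℝ w).integrable_comp hξ)
      (hweak w hw) ha hab hb, inner_sub_left]

/-- The integral telescopes to the one over (b-h,b) minus the one over (a-h,a), and each average
converges to the value at the endpoint. -/
theorem tendsto_average_sub_shift {y : ℝ → ℝ} (hy : Continuous y) (a b : ℝ) :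
    Tendsto (fun h : ℝ => h⁻¹ * ∫ t in a..b, (y t - y (t - h))) (𝓝[>] 0) (𝓝 (y b - y a)) := by
  have hii : ∀ c d, IntervalIntegrable y volume c d := fun c d => hy.intervalIntegrable c d
  have key : ∀ c, Tendsto (fun h : ℝ => h⁻¹ * ∫ t in (c - h)..c, y t) (𝓝[>] 0) (𝓝 (y c)) := by
    intro c
    have h1 : HasDerivAt (fun h : ℝ => ∫ t in (c - h)..c, y t) (y c) 0 := by
      have h2 : HasDerivAt (fun x : ℝ => ∫ t in x..c, y t) (-y (c - 0)) (c - 0) :=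
        intervalIntegral.integral_hasDerivAt_left (hii _ _)
          (hy.stronglyMeasurableAtFilter _ _) hy.continuousAt
      have h3 : HasDerivAt (fun h : ℝ => c - h) (-1) 0 := by
        simpa using (hasDerivAt_id (0 : ℝ)).const_sub c
      have := h2.comp (0 : ℝ) h3
      simpa [Function.comp_def] using this
    have := h1.tendsto_slope_zero_right
    simpa using this
  refine ((key b).sub (key a)).congr fun h => ?_
  have hs : IntervalIntegrable (fun t => y (t - h)) volume a b :=
    Continuous.intervalIntegrable (by fun_prop) _ _
  rw [← mul_sub, intervalIntegral.integral_sub (hii _ _) hs, intervalIntegral.integral_comp_sub_right]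
  congr 1
  rw [← intervalIntegral.integral_interval_sub_left (hii 0 b) (hii 0 (b - h)),
    ← intervalIntegral.integral_interval_sub_left (hii 0 a) (hii 0 (a - h)),
    ← intervalIntegral.integral_interval_sub_left (hii 0 b) (hii 0 a),
    ← intervalIntegral.integral_interval_sub_left (hii 0 (b - h)) (hii 0 (a - h))]
  ring

/-- Translations act on the whole line, so `ξ` is extended by zero; the strongly measurable
representative serves the double integral in (t,σ). -/
theorem exists_memLp_extension {X Y : Type*} [MeasurableSpace X] {μ : Measure X}
    [NormedAddCommGroup Y] {q : ℝ≥0∞} {A : Set X} (hA : MeasurableSet A) {f : X → Y}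
    (hf : MemLp f q (μ.restrict A)) :
    ∃ F : X → Y, StronglyMeasurable F ∧ MemLp F q μ ∧ f =ᵐ[μ.restrict A] F :=
  ⟨A.indicator (hf.1.mk f), hf.1.stronglyMeasurable_mk.indicator hA,
    (memLp_indicator_iff_restrict hA).2 (hf.ae_eq hf.1.ae_eq_mk),
    hf.1.ae_eq_mk.trans (indicator_ae_eq_restrict hA).symm⟩

/-- Integrate the backward difference quotient of ‖U‖² over (a,b) and let h → 0. Restricting to h <
a keeps [t-h,t] inside [0,T], where U(t) - U(t-h) is the integral of `ξ`. -/
theorem energy_inequality_of_pos {T : ℝ} {J : V →L[ℝ] H} {U : ℝ → H} (hU : Continuous U)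
    {q r : ℝ≥0∞} [Fact (1 ≤ q)] (hq : q ≠ ⊤) [q.HolderConjugate r]
    {ξ : ℝ → StrongDual ℝ V} (hξ : MemLp ξ q (volume.restrict (Ioo 0 T)))
    {u : ℝ → V} (hu : MemLp u r (volume.restrict (Ioo 0 T)))
    (hJ : ∀ᵐ t ∂(volume.restrict (Ioo 0 T)), J (u t) = U t) {D : Set V} (hD : Dense D)
    (hweak : ∀ w ∈ D, ∀ φ : ℝ → ℝ, IsTest (Ioo 0 T) φ →
      ∫ t in Ioo 0 T, φ t * ξ t w = -∫ t in Ioo 0 T, deriv φ t * inner ℝ (U t) (J w))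
    {a b : ℝ} (ha : 0 < a) (hab : a ≤ b) (hb : b ≤ T) :
    ‖U b‖ ^ 2 - ‖U a‖ ^ 2 ≤ 2 * ∫ t in Ioo a b, ξ t (u t) := by
  have hsub : Ioo a b ⊆ Ioo 0 T := Ioo_subset_Ioo ha.le hb
  obtain ⟨F, hFm, hF, hξF⟩ := exists_memLp_extension measurableSet_Ioo hξ
  set w : ℝ → V := (Ioo a b).indicator u
  have hw : MemLp w r volume := (memLp_indicator_iff_restrict measurableSet_Ioo).2
    (hu.mono_measure (Measure.restrict_mono hsub le_rfl))
  obtain ⟨hinteg, hlim⟩ := tendsto_integral_steklov hq hFm hF hw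
  have hξi : IntegrableOn ξ (Ioo 0 T) := hξ.integrable Fact.out
  have hFi : IntegrableOn F (Ioo 0 T) := hξi.congr hξF
  have hweak' : ∀ w ∈ D, ∀ φ : ℝ → ℝ, IsTest (Ioo 0 T) φ →
      ∫ t in Ioo 0 T, φ t * F t w = -∫ t in Ioo 0 T, deriv φ t * inner ℝ (U t) (J w) := by
    intro w hw φ hφ
    rw [← hweak w hw φ hφ]
    refine integral_congr_ae ?_
    filter_upwards [hξF] with t ht
    rw [ht]
  have hy : Continuous fun t => ‖U t‖ ^ 2 := hU.norm.pow 2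
  have hlimL := tendsto_average_sub_shift hy a b
  have e : ∫ t, F t (w t) = ∫ t in Ioo a b, ξ t (u t) := by
    rw [← integral_indicator measurableSet_Ioo]
    have h1 := (ae_restrict_iff' measurableSet_Ioo).1 hξF
    refine integral_congr_ae ?_
    filter_upwards [h1] with t ht
    by_cases h : t ∈ Ioo a b
    · simp only [w, indicator_of_mem h]
      rw [ht (hsub h)]
    · simp [w, indicator_of_notMem h]
  rw [e] at hlim
  refine le_of_tendsto_of_tendsto hlimL (hlim.const_mul 2) ?_
  filter_upwards [hinteg, Ioo_mem_nhdsGT ha] with h hi hh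
  have hh0 : 0 < h := hh.1
  have e2 : ∫ t, h⁻¹ * (∫ τ in t - h..t, F τ) (w t)
      = ∫ t in Ioo a b, h⁻¹ * (∫ τ in t - h..t, F τ) (w t) := by
    refine (setIntegral_eq_integral_of_forall_compl_eq_zero fun t ht => ?_).symm
    simp [w, indicator_of_notMem ht]
  have hyc : Continuous fun t => ‖U t‖ ^ 2 - ‖U (t - h)‖ ^ 2 :=
    hy.sub (hy.comp (continuous_id.sub continuous_const))
  rw [e2, intervalIntegral.integral_of_le hab, integral_Ioc_eq_integral_Ioo,
    ← integral_const_mul, ← integral_const_mul]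
  refine integral_mono_ae ?_ (hi.integrableOn.const_mul 2) ?_
  · exact ((hyc.integrableOn_Icc (a := a) (b := b)).mono_set Ioo_subset_Icc_self).const_mul _
  have hJ' := ae_restrict_of_ae_restrict_of_subset hsub hJ
  filter_upwards [hJ', ae_restrict_mem measurableSet_Ioo] with t hJt ht
  have hin := inner_sub_eq_integral_apply hU hFi hD hweak'
    (a := t - h) (b := t) (by linarith [ht.1, hh.2]) (by linarith) (by linarith [ht.2]) (u t)
  simp only [w, indicator_of_mem ht]
  rw [← hin, hJt]
  -- The right side exceeds the left by exactly ‖U(t) - U(t-h)‖², which is discarded.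
  have hpol : ‖U t‖ ^ 2 - ‖U (t - h)‖ ^ 2 ≤ 2 * inner ℝ (U t - U (t - h)) (U t) := by
    have h1 := norm_sub_sq_real (U t) (U (t - h))
    rw [inner_sub_left, real_inner_self_eq_norm_sq, real_inner_comm]
    nlinarith [sq_nonneg ‖U t - U (t - h)‖]
  calc h⁻¹ * (‖U t‖ ^ 2 - ‖U (t - h)‖ ^ 2)
      ≤ h⁻¹ * (2 * inner ℝ (U t - U (t - h)) (U t)) := by gcongr
    _ = _ := by ring

/-- The energy inequality `‖u(b)‖² - ‖u(a)‖² ≤ 2 ∫_a^b ⟨u_t, u⟩`. -/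
theorem energy_inequality {T : ℝ} {J : V →L[ℝ] H} {U : ℝ → H} (hU : ContinuousOn U (Icc 0 T))
    {q r : ℝ≥0∞} [Fact (1 ≤ q)] (hq : q ≠ ⊤) [q.HolderConjugate r]
    {ξ : ℝ → StrongDual ℝ V} (hξ : MemLp ξ q (volume.restrict (Ioo 0 T)))
    {u : ℝ → V} (hu : MemLp u r (volume.restrict (Ioo 0 T)))
    (hJ : ∀ᵐ t ∂(volume.restrict (Ioo 0 T)), J (u t) = U t) {D : Set V} (hD : Dense D)
    (hweak : ∀ w ∈ D, ∀ φ : ℝ → ℝ, IsTest (Ioo 0 T) φ →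
      ∫ t in Ioo 0 T, φ t * ξ t w = -∫ t in Ioo 0 T, deriv φ t * inner ℝ (U t) (J w))
    {a b : ℝ} (ha : 0 < a) (hab : a ≤ b) (hb : b ≤ T) :
    ‖U b‖ ^ 2 - ‖U a‖ ^ 2 ≤ 2 * ∫ t in Ioo a b, ξ t (u t) := by
  have hT : 0 ≤ T := by linarith
  -- Extending by the endpoint values makes the curve continuous on all of ℝ.
  set U' : ℝ → H := IccExtend hT ((Icc 0 T).domRestrict U)
  have hU' : Continuous U' := (continuousOn_iff_continuous_domRestrict.1 hU).Icc_extend'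
  have heq : ∀ t ∈ Icc 0 T, U' t = U t := fun t ht => by
    simp only [U', IccExtend_of_mem hT _ ht, domRestrict_apply]
  rw [← heq b ⟨by linarith, hb⟩, ← heq a ⟨ha.le, by linarith⟩]
  refine energy_inequality_of_pos (J := J) hU' hq hξ hu ?_ hD ?_ ha hab hb
  · filter_upwards [hJ, ae_restrict_mem measurableSet_Ioo] with t ht h
    rw [ht, heq t (Ioo_subset_Icc_self h)]
  · intro w hw φ hφ
    rw [hweak w hw φ hφ]
    congr 1
    refine setIntegral_congr_fun measurableSet_Ioo fun t ht => ?_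
    simp only [heq t (Ioo_subset_Icc_self ht)]

end Energy

/-! ### Extinction for the integrated differential inequality -/

/-- As `y` is only continuous, it is compared with the C¹ function Y(x) = y(t) + c ∫_x^t y^(1-θ). On
[a,t] one has 0 < y(t) ≤ Y ≤ y, so Y' = -c y^(1-θ) ≤ -c Y^(1-θ) and Y^θ + cθx is nonincreasing.
Working back from a time with y(t) > 0 avoids dividing by zero. -/
theorem rpow_add_le_of_integral_inequality {y : ℝ → ℝ} {c θ a t : ℝ} (hc : 0 < c) (hθ : 0 < θ)
    (hθ1 : θ < 1) (hy : Continuous y) (hy0 : ∀ x, 0 ≤ y x) (hat : a ≤ t) (hyt : 0 < y t)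
    (H : ∀ x ∈ Icc a t, y t - y x ≤ -(c * ∫ τ in x..t, y τ ^ (1 - θ))) :
    y t ^ θ + c * θ * t ≤ y a ^ θ + c * θ * a := by
  have hcont : Continuous fun τ => y τ ^ (1 - θ) :=
    hy.rpow_const fun _ => Or.inr (by linarith)
  set Y : ℝ → ℝ := fun x => y t + c * ∫ τ in x..t, y τ ^ (1 - θ) with hY
  have hYy : ∀ x ∈ Icc a t, Y x ≤ y x := fun x hx => by
    have := H x hx
    simp only [hY]; linarith
  have hYd : ∀ x, HasDerivAt Y (c * -(y x ^ (1 - θ))) x := fun x =>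
    ((intervalIntegral.integral_hasDerivAt_left (hcont.intervalIntegrable _ _)
      (hcont.stronglyMeasurableAtFilter _ _) hcont.continuousAt).const_mul c).const_add _
  have hYt : Y t = y t := by simp [hY]
  have hYanti : ∀ x ∈ Icc a t, 0 < Y x := by
    intro x hx
    have : 0 ≤ ∫ τ in x..t, y τ ^ (1 - θ) :=
      intervalIntegral.integral_nonneg hx.2 fun τ _ => Real.rpow_nonneg (hy0 τ) _
    simp only [hY]; positivity
  have hanti : AntitoneOn (fun x => Y x ^ θ + c * θ * x) (Icc a t) := by
    have hder : ∀ x ∈ Icc a t, HasDerivAt (fun x => Y x ^ θ + c * θ * x)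
        (c * -(y x ^ (1 - θ)) * θ * Y x ^ (θ - 1) + c * θ) x := fun x hx => by
      have h2 : HasDerivAt (fun x : ℝ => c * θ * x) (c * θ) x := by
        simpa using (hasDerivAt_id x).const_mul (c * θ)
      exact ((hYd x).rpow_const (Or.inl (hYanti x hx).ne')).add h2
    refine antitoneOn_of_deriv_nonpos (convex_Icc a t)
      (fun x hx => (hder x hx).continuousAt.continuousWithinAt)
      (fun x hx => (hder x (interior_subset hx)).differentiableAt.differentiableWithinAt)
      fun x hx => ?_
    have hx' := interior_subset hx
    rw [(hder x hx').deriv]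
    have h1 : Y x ^ (1 - θ) ≤ y x ^ (1 - θ) :=
      Real.rpow_le_rpow (hYanti x hx').le (hYy x hx') (by linarith)
    have h2 : Y x ^ (1 - θ) * Y x ^ (θ - 1) = 1 := by
      rw [← Real.rpow_add (hYanti x hx')]; simp
    have h3 : 1 ≤ y x ^ (1 - θ) * Y x ^ (θ - 1) := by
      exact h2.symm.le.trans
        (mul_le_mul_of_nonneg_right h1 (Real.rpow_nonneg (hYanti x hx').le _))
    have h4 : 0 < c * θ := by positivity
    nlinarith
  have h1 := hanti (left_mem_Icc.2 hat) (right_mem_Icc.2 hat) hat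
  simp only [hYt] at h1
  have h2 : Y a ^ θ ≤ y a ^ θ :=
    Real.rpow_le_rpow (hYanti a (left_mem_Icc.2 hat)).le (hYy a (left_mem_Icc.2 hat)) hθ.le
  linarith

/-- Extinction in finite time for `y' ≤ -c y^{1-θ}` in integrated form. -/
theorem eq_zero_of_integral_inequality {y : ℝ → ℝ} {c θ T : ℝ} (hc : 0 < c) (hθ : 0 < θ)
    (hθ1 : θ < 1) (hT : 0 ≤ T) (hy : ContinuousOn y (Icc 0 T)) (hy0 : ∀ t ∈ Icc 0 T, 0 ≤ y t)
    (H : ∀ a b, 0 < a → a ≤ b → b ≤ T → y b - y a ≤ -(c * ∫ t in a..b, y t ^ (1 - θ)))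
    {t : ℝ} (ht : y 0 ^ θ / (c * θ) ≤ t) (htT : t ≤ T) : y t = 0 := by
  have hcθ : 0 < c * θ := by positivity
  have hpow0 : 0 ≤ y 0 ^ θ := Real.rpow_nonneg (hy0 0 ⟨le_rfl, hT⟩) _
  have ht0 : 0 ≤ t := (div_nonneg hpow0 hcθ.le).trans ht
  rw [div_le_iff₀ hcθ] at ht
  rcases eq_or_lt_of_le ht0 with rfl | htpos
  · have : y 0 ^ θ = 0 := le_antisymm (by simpa using ht) hpow0
    exact ((Real.rpow_eq_zero_iff_of_nonneg (hy0 0 ⟨le_rfl, hT⟩)).1 this).1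
  set z : ℝ → ℝ := IccExtend hT ((Icc 0 T).domRestrict y)
  have hz : Continuous z := (continuousOn_iff_continuous_domRestrict.1 hy).Icc_extend'
  have heq : ∀ t ∈ Icc 0 T, z t = y t := fun t ht => by
    simp only [z, IccExtend_of_mem hT _ ht, domRestrict_apply]
  have h0 : (0 : ℝ) ∈ Icc 0 T := ⟨le_rfl, hT⟩
  have htm : t ∈ Icc 0 T := ⟨ht0, htT⟩
  have hz0 : ∀ x, 0 ≤ z x := fun x => by
    simp only [z, IccExtend, Function.comp_apply, domRestrict_apply]
    exact hy0 _ (projIcc 0 T hT x).2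
  by_contra hne
  have hyt : 0 < z t := by
    rw [heq t htm]; exact lt_of_le_of_ne (hy0 t htm) (Ne.symm hne)
  have key : ∀ a ∈ Ioo 0 t, z t ^ θ + c * θ * t ≤ z a ^ θ + c * θ * a := by
    intro a ha
    refine rpow_add_le_of_integral_inequality hc hθ hθ1 hz hz0 ha.2.le hyt fun x hx => ?_
    have hx0 : 0 < x := ha.1.trans_le hx.1
    rw [heq t htm, heq x ⟨hx0.le, hx.2.trans htT⟩]
    refine (H x t hx0 hx.2 htT).trans (le_of_eq ?_)
    congr 2
    refine intervalIntegral.integral_congr fun τ hτ => ?_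
    rw [uIcc_of_le hx.2] at hτ
    simp only [heq τ ⟨hx0.le.trans hτ.1, hτ.2.trans htT⟩]
  have hlim : Tendsto (fun a => z a ^ θ + c * θ * a) (𝓝[>] 0) (𝓝 (z 0 ^ θ + c * θ * 0)) := by
    have : Continuous fun a => z a ^ θ + c * θ * a :=
      (hz.rpow_const fun _ => Or.inr hθ.le).add (continuous_const.mul continuous_id)
    exact (this.tendsto 0).mono_left nhdsWithin_le_nhds
  -- Letting a → 0 gives y(t)^θ + cθt ≤ y(0)^θ ≤ cθt, which contradicts y(t) > 0.
  have hfin := ge_of_tendsto hlim (eventually_of_mem (Ioo_mem_nhdsGT htpos) key)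
  rw [heq 0 h0] at hfin
  have : 0 < z t ^ θ := by positivity
  linarith

/-! ### The space `W0` and its embedding in L²(Ω) -/

theorem measurableSet_DOmega {N : ℕ} {Ω : Set (E N)} (hΩ : IsOpen Ω) :
    MeasurableSet (DOmega Ω) :=
  (hΩ.measurableSet.compl.prod hΩ.measurableSet.compl).compl

theorem ae_nu_of_ae {N : ℕ} {s p : ℝ} {Ω : Set (E N)} {P : E N → Prop} (h : ∀ᵐ x, P x) :
    ∀ᵐ z ∂((nu N s p).restrict (DOmega Ω)), P z.1 ∧ P z.2 := by
  refine ae_restrict_of_ae ((withDensity_absolutelyContinuous _ _).ae_le ?_)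
  rw [Measure.volume_eq_prod]
  exact (Measure.quasiMeasurePreserving_fst.ae h).and (Measure.quasiMeasurePreserving_snd.ae h)

namespace W0

variable {N : ℕ} {s p : ℝ} [Fact (1 < p)] {Ω : Set (E N)}

/-- The elements of `W_0^{s,p}(Ω)` that come from test functions. -/
def testSet (s p : ℝ) [Fact (1 < p)] (Ω : Set (E N)) : Set (W0 s p Ω) :=
  {w | W0.incl s p Ω w ∈ testSubmodule s p Ω}

theorem dense_testSet : Dense (testSet s p Ω) := by
  intro v
  have hv : W0.incl s p Ω v ∈ closure (testSubmodule s p Ω : Set (Ambient s p Ω)) := v.2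
  rw [mem_closure_iff_seq_limit] at hv ⊢
  obtain ⟨x, hx, hlim⟩ := hv
  refine ⟨fun n => ⟨x n, subset_closure (hx n)⟩, fun n => hx n, ?_⟩
  exact tendsto_subtype_rng.2 hlim

theorem fn_add (v w : W0 s p Ω) : (v + w).fn =ᵐ[volume] v.fn + w.fn := by
  unfold W0.fn
  rw [map_add]
  exact Lp.coeFn_add _ _

theorem fn_smul (c : ℝ) (v : W0 s p Ω) : (c • v).fn =ᵐ[volume] c • v.fn := by
  unfold W0.fn
  rw [map_smul]
  exact Lp.coeFn_smul _ _

theorem exists_test_seq (v : W0 s p Ω) :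
    ∃ (φ : ℕ → E N → ℝ) (w : ℕ → W0 s p Ω), (∀ n, IsTest Ω (φ n)) ∧
      (∀ n, (w n).fn =ᵐ[volume] φ n) ∧
      (∀ n, (W0.incl s p Ω (w n)).2 =ᵐ[(nu N s p).restrict (DOmega Ω)]
        fun z => φ n z.1 - φ n z.2) ∧
      Tendsto w atTop (𝓝 v) ∧ ∀ᵐ x, Tendsto (fun n => φ n x) atTop (𝓝 (v.fn x)) := by
  obtain ⟨w, hw, hlim⟩ := mem_closure_iff_seq_limit.1 (dense_testSet v)
  have h1 : Tendsto (fun n => (W0.incl s p Ω (w n)).1) atTop (𝓝 (W0.incl s p Ω v).1) :=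
    (continuous_fst.tendsto _).comp (((W0.incl s p Ω).continuous.tendsto v).comp hlim)
  obtain ⟨ns, hns, hae⟩ := (tendstoInMeasure_of_tendsto_Lp h1).exists_seq_tendsto_ae
  choose φ hφ e1 e2 using hw
  refine ⟨fun n => φ (ns n), fun n => w (ns n), fun n => hφ _, fun n => e1 _, fun n => e2 _,
    hlim.comp hns.tendsto_atTop, ?_⟩
  filter_upwards [hae, ae_all_iff.2 fun n => e1 (ns n)] with x hx hx'
  exact hx.congr hx'

/-- The closure adds no spurious pairs: along a subsequence both components converge a.e., and
Lebesgue-null sets give ν-null sets in either variable, so the limit is still a difference. -/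
theorem snd_ae_eq (v : W0 s p Ω) :
    (W0.incl s p Ω v).2 =ᵐ[(nu N s p).restrict (DOmega Ω)] fun z => v.fn z.1 - v.fn z.2 := by
  obtain ⟨φ, w, -, -, e2, hlim, hae⟩ := exists_test_seq v
  have h1 : Tendsto (fun n => (W0.incl s p Ω (w n)).2) atTop (𝓝 (W0.incl s p Ω v).2) :=
    (continuous_snd.tendsto _).comp (((W0.incl s p Ω).continuous.tendsto v).comp hlim)
  obtain ⟨ns, hns, hae2⟩ := (tendstoInMeasure_of_tendsto_Lp h1).exists_seq_tendsto_ae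
  filter_upwards [hae2, ae_all_iff.2 fun n => e2 (ns n), ae_nu_of_ae hae] with z h h' h''
  refine tendsto_nhds_unique (h.congr h') ?_
  exact (h''.1.sub h''.2).comp hns.tendsto_atTop

theorem lintegral_nu_eq_setLIntegral (hΩ : IsOpen Ω) {φ : E N → ℝ} (hφ : IsTest Ω φ) :
    ∫⁻ z, ‖φ z.1 - φ z.2‖ₑ ^ p ∂(nu N s p)
      = ∫⁻ z in DOmega Ω, ‖φ z.1 - φ z.2‖ₑ ^ p ∂(nu N s p) := by
  have hp : 0 < p := zero_lt_one.trans Fact.out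
  have h0 : ∀ x ∉ Ω, φ x = 0 := fun x hx => by
    by_contra h
    exact hx (hφ.support (subset_tsupport φ h))
  rw [← lintegral_indicator (measurableSet_DOmega hΩ)]
  refine lintegral_congr fun z => ?_
  by_cases hz : z ∈ DOmega Ω
  · rw [indicator_of_mem hz]
  · rw [indicator_of_notMem hz]
    have hz' : z ∈ Ωᶜ ×ˢ Ωᶜ := not_not.1 hz
    rw [h0 _ hz'.1, h0 _ hz'.2]
    simp [hp]

/-- The fractional Sobolev inequality in `W_0^{s,p}(Ω)`. -/
theorem eLpNorm_fn_le (hs : 0 < s) (hps : p * s < N) (hΩ : IsOpen Ω) {S : ℝ}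
    (hS : IsSobolevConst N s p S) (v : W0 s p Ω) :
    eLpNorm v.fn (ENNReal.ofReal (critExp N s p)) volume
      ≤ ENNReal.ofReal (S ^ (-(1 / p))) * ‖(W0.incl s p Ω v).2‖ₑ := by
  have hp : 0 < p := zero_lt_one.trans Fact.out
  have hq := critExp_pos hp hs hps
  set q := critExp N s p with hqdef
  have htest : ∀ (φ : E N → ℝ) (w : W0 s p Ω), IsTest Ω φ →
      (W0.incl s p Ω w).2 =ᵐ[(nu N s p).restrict (DOmega Ω)] (fun z => φ z.1 - φ z.2) →
      eLpNorm φ (ENNReal.ofReal q) volume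
        ≤ ENNReal.ofReal (S ^ (-(1 / p))) * ‖(W0.incl s p Ω w).2‖ₑ := by
    intro φ w hφ hw
    have hSob := hS.2 φ ⟨hφ.smooth, hφ.compact, subset_univ _⟩
    rw [lintegral_nu_eq_setLIntegral hΩ hφ, ← hqdef] at hSob
    have e1 : eLpNorm φ (ENNReal.ofReal q) volume = (∫⁻ x, ‖φ x‖ₑ ^ q) ^ (1 / q) := by
      rw [eLpNorm_eq_lintegral_rpow_enorm_toReal (by simpa using hq) ENNReal.ofReal_ne_top,
        ENNReal.toReal_ofReal hq.le]
    have e2 : ‖(W0.incl s p Ω w).2‖ₑ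
        = (∫⁻ z in DOmega Ω, ‖φ z.1 - φ z.2‖ₑ ^ p ∂(nu N s p)) ^ (1 / p) := by
      rw [Lp.enorm_def, eLpNorm_congr_ae hw,
        eLpNorm_eq_lintegral_rpow_enorm_toReal (by simpa using hp) ENNReal.ofReal_ne_top,
        ENNReal.toReal_ofReal hp.le]
    have h3 := ENNReal.rpow_le_rpow hSob (z := 1 / p) (by positivity)
    rw [ENNReal.mul_rpow_of_nonneg _ _ (by positivity), ← ENNReal.rpow_mul, ← e2,
      show p / q * (1 / p) = 1 / q by field_simp, ← e1,
      ENNReal.ofReal_rpow_of_pos hS.1] at h3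
    calc _ = ENNReal.ofReal (S ^ (-(1 / p))) * (ENNReal.ofReal (S ^ (1 / p)) *
          eLpNorm φ (ENNReal.ofReal q) volume) := by
          rw [← mul_assoc, ← ENNReal.ofReal_mul (Real.rpow_nonneg hS.1.le _),
            ← Real.rpow_add hS.1, neg_add_cancel, Real.rpow_zero, ENNReal.ofReal_one, one_mul]
      _ ≤ _ := by gcongr
  obtain ⟨φ, w, hφ, -, e2, hlim, hae⟩ := exists_test_seq v
  -- Fatou's lemma along test functions converging a.e.; the seminorms on the right converge.
  refine (Lp.eLpNorm_lim_le_liminf_eLpNorm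
    (fun n => (hφ n).smooth.continuous.aestronglyMeasurable) _ hae).trans ?_
  have h1 : Tendsto (fun n => ENNReal.ofReal (S ^ (-(1 / p))) * ‖(W0.incl s p Ω (w n)).2‖ₑ)
      atTop (𝓝 (ENNReal.ofReal (S ^ (-(1 / p))) * ‖(W0.incl s p Ω v).2‖ₑ)) := by
    refine ENNReal.Tendsto.const_mul ?_ (Or.inr ENNReal.ofReal_ne_top)
    exact (continuous_enorm.comp (continuous_snd.comp (W0.incl s p Ω).continuous)).tendsto v
      |>.comp hlim
  rw [← h1.liminf_eq]
  exact liminf_le_liminf (Eventually.of_forall fun n => htest _ _ (hφ n) (e2 n))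

theorem eLpNorm_two_fn_le (hs : 0 < s) (hps : p * s < N) (hq2 : 2 ≤ critExp N s p)
    (hΩ : IsOpen Ω) (hb : Bornology.IsBounded Ω) {S : ℝ}
    (hS : IsSobolevConst N s p S) (v : W0 s p Ω) :
    eLpNorm v.fn 2 (volume.restrict Ω) ≤ ENNReal.ofReal (S ^ (-(1 / p)) *
      volume.real Ω ^ (1 / 2 - 1 / critExp N s p) * ‖(W0.incl s p Ω v).2‖) := by
  have hq0 : 0 < critExp N s p := by linarith
  have hfin : volume Ω ≠ ⊤ := hb.measure_lt_top.ne
  have hm : AEStronglyMeasurable v.fn (volume.restrict Ω) :=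
    (Lp.aestronglyMeasurable (W0.incl s p Ω v).1).restrict
  have h2q : (2 : ℝ≥0∞) ≤ ENNReal.ofReal (critExp N s p) := by
    rw [← ENNReal.ofReal_ofNat]
    exact ENNReal.ofReal_le_ofReal hq2
  have hexp : 0 ≤ 1 / 2 - 1 / critExp N s p := by
    have := one_div_le_one_div_of_le two_pos hq2
    linarith
  have h1 := eLpNorm_le_eLpNorm_mul_rpow_measure_univ h2q hm
  rw [Measure.restrict_apply_univ, ENNReal.toReal_ofReal hq0.le, ENNReal.toReal_ofNat] at h1
  refine h1.trans ?_
  rw [mul_right_comm, ENNReal.ofReal_mul (by have := hS.1; positivity),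
    ENNReal.ofReal_mul (Real.rpow_nonneg hS.1.le _), ofReal_norm,
    ← ENNReal.ofReal_rpow_of_nonneg measureReal_nonneg hexp, ofReal_measureReal hfin]
  gcongr
  exact (eLpNorm_mono_measure _ Measure.restrict_le_self).trans (eLpNorm_fn_le hs hps hΩ hS v)

/-- The embedding of `W_0^{s,p}(Ω)` in `L²(Ω)`. -/
theorem exists_toL2 (hs : 0 < s) (hps : p * s < N) (hq2 : 2 ≤ critExp N s p)
    (hΩ : IsOpen Ω) (hb : Bornology.IsBounded Ω) {S : ℝ} (hS : IsSobolevConst N s p S) :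
    ∃ J : W0 s p Ω →L[ℝ] Lp ℝ 2 (volume.restrict Ω), ∀ v,
      J v =ᵐ[volume.restrict Ω] v.fn ∧ ‖J v‖ ≤ S ^ (-(1 / p)) *
        volume.real Ω ^ (1 / 2 - 1 / critExp N s p) * ‖(W0.incl s p Ω v).2‖ := by
  have hmem : ∀ v : W0 s p Ω, MemLp v.fn 2 (volume.restrict Ω) := fun v =>
    ⟨(Lp.aestronglyMeasurable (W0.incl s p Ω v).1).restrict,
      (eLpNorm_two_fn_le hs hps hq2 hΩ hb hS v).trans_lt ENNReal.ofReal_lt_top⟩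
  have hK : 0 ≤ S ^ (-(1 / p)) * volume.real Ω ^ (1 / 2 - 1 / critExp N s p) := by
    have := hS.1
    positivity
  have hbound : ∀ v : W0 s p Ω, ‖(hmem v).toLp v.fn‖ ≤ S ^ (-(1 / p)) *
      volume.real Ω ^ (1 / 2 - 1 / critExp N s p) * ‖(W0.incl s p Ω v).2‖ := fun v => by
    rw [Lp.norm_toLp]
    exact ENNReal.toReal_le_of_le_ofReal (by positivity)
      (eLpNorm_two_fn_le hs hps hq2 hΩ hb hS v)
  let L : W0 s p Ω →ₗ[ℝ] Lp ℝ 2 (volume.restrict Ω) :=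
    { toFun := fun v => (hmem v).toLp v.fn
      map_add' := fun v w => by
        rw [← MemLp.toLp_add]
        exact MemLp.toLp_congr _ _ (ae_restrict_of_ae (fn_add v w))
      map_smul' := fun c v => by
        rw [RingHom.id_apply, ← MemLp.toLp_const_smul]
        exact MemLp.toLp_congr _ _ (ae_restrict_of_ae (fn_smul c v)) }
  refine ⟨L.mkContinuous (S ^ (-(1 / p)) * volume.real Ω ^ (1 / 2 - 1 / critExp N s p))
    fun v => (hbound v).trans ?_, fun v => ⟨(hmem v).coeFn_toLp, hbound v⟩⟩
  gcongr
  exact norm_snd_le (W0.incl s p Ω v)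

theorem norm_snd_rpow_eq_integral (v : W0 s p Ω) :
    ‖(W0.incl s p Ω v).2‖ ^ p
      = ∫ z in DOmega Ω, |(W0.incl s p Ω v).2 z| ^ p ∂(nu N s p) := by
  have hp : 0 < p := zero_lt_one.trans Fact.out
  have h0 : 0 ≤ ∫ z in DOmega Ω, |(W0.incl s p Ω v).2 z| ^ p ∂(nu N s p) :=
    integral_nonneg fun z => Real.rpow_nonneg (abs_nonneg _) _
  rw [Lp.norm_def, (Lp.memLp (W0.incl s p Ω v).2).eLpNorm_eq_integral_rpow_norm
    (by simpa using hp) ENNReal.ofReal_ne_top, ENNReal.toReal_ofReal hp.le]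
  simp only [Real.norm_eq_abs]
  rw [ENNReal.toReal_ofReal (Real.rpow_nonneg h0 _), ← Real.rpow_mul h0,
    inv_mul_cancel₀ hp.ne', Real.rpow_one]

theorem pForm_self {u : E N → ℝ} {v : W0 s p Ω} (h : v.fn =ᵐ[volume] u) :
    pForm s p Ω u v.fn = 1 / 2 * ‖(W0.incl s p Ω v).2‖ ^ p := by
  have hp : 0 < p := zero_lt_one.trans Fact.out
  rw [pForm, norm_snd_rpow_eq_integral]
  congr 1
  refine integral_congr_ae ?_
  filter_upwards [snd_ae_eq v, ae_nu_of_ae h] with z hz hz'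
  rw [hz, hz'.1, hz'.2]
  set d := u z.1 - u z.2
  rcases eq_or_ne d 0 with hd | hd
  · rw [hd]; simp [hp.ne']
  · have : |d| ^ p = |d| ^ (p - 2) * |d| ^ (2 : ℝ) := by
      rw [← Real.rpow_add (abs_pos.2 hd)]; congr 1; ring
    rw [this, Real.rpow_two, sq_abs]
    ring

theorem pForm_zero (u : E N → ℝ) : pForm s p Ω u (0 : W0 s p Ω).fn = 0 := by
  have h : (0 : W0 s p Ω).fn =ᵐ[volume] 0 := by
    unfold W0.fn
    rw [map_zero]
    exact Lp.coeFn_zero _ _ _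
  rw [pForm, integral_eq_zero_of_ae, mul_zero]
  filter_upwards [ae_nu_of_ae h] with z hz
  rw [hz.1, hz.2]
  simp

end W0

/-! ### Solutions as curves in L²(Ω) -/

section L2Curve

variable {X : Type*} [MeasurableSpace X] {μ : Measure X}

open Classical in
/-- A function as an element of `L²` (zero if it is not square integrable). -/
noncomputable def toL2 (μ : Measure X) (f : X → ℝ) : Lp ℝ 2 μ :=
  if h : MemLp f 2 μ then h.toLp f else 0

theorem toL2_ae_eq {f : X → ℝ} (h : MemLp f 2 μ) : toL2 μ f =ᵐ[μ] f := by
  rw [toL2, dif_pos h]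
  exact h.coeFn_toLp

theorem edist_toL2 {f g : X → ℝ} (hf : MemLp f 2 μ) (hg : MemLp g 2 μ) :
    edist (toL2 μ f) (toL2 μ g) = eLpNorm (f - g) 2 μ := by
  rw [Lp.edist_def]
  exact eLpNorm_congr_ae ((toL2_ae_eq hf).sub (toL2_ae_eq hg))

theorem norm_toL2 {f : X → ℝ} (hf : MemLp f 2 μ) : ‖toL2 μ f‖ = (eLpNorm f 2 μ).toReal := by
  rw [Lp.norm_def, eLpNorm_congr_ae (toL2_ae_eq hf)]

theorem tendsto_toL2 {ι : Type*} {l : Filter ι} {f : ι → X → ℝ} {g : X → ℝ}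
    (hf : ∀ᶠ i in l, MemLp (f i) 2 μ) (hg : MemLp g 2 μ)
    (h : Tendsto (fun i => eLpNorm (f i - g) 2 μ) l (𝓝 0)) :
    Tendsto (fun i => toL2 μ (f i)) l (𝓝 (toL2 μ g)) := by
  rw [tendsto_iff_edist_tendsto_0]
  refine h.congr' ?_
  filter_upwards [hf] with i hi
  exact (edist_toL2 hi hg).symm

end L2Curve

/-- Both inequalities amount to 2N ≤ p(N + 2s). -/
theorem two_le_critExp {N : ℕ} {s p : ℝ} (hs : 0 < s) (hps : p * s < N)
    (hp : 2 * (N : ℝ) / (N + 2 * s) ≤ p) : 2 ≤ critExp N s p := by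
  have hN : (0 : ℝ) ≤ N := N.cast_nonneg
  rw [div_le_iff₀ (by linarith)] at hp
  unfold critExp
  rw [le_div_iff₀ (by linarith)]
  linarith

/-! ### Dissipation and extinction of energy solutions -/

namespace IsEnergySolution

variable {N : ℕ} {s p : ℝ} [Fact (1 < p)] {Ω : Set (E N)} {T : ℝ} {u₀ : E N → ℝ}
  {u : ℝ → E N → ℝ}

theorem continuousOn_toL2 {f : ℝ → StrongDual ℝ (W0 s p Ω)}
    (hu : IsEnergySolution s p Ω T f u₀ u) :
    ContinuousOn (fun t => toL2 (volume.restrict Ω) (u t)) (Icc 0 T) := fun t₀ ht₀ =>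
  tendsto_toL2 (eventually_mem_nhdsWithin.mono fun t ht => hu.memLp_two t ht)
    (hu.memLp_two t₀ ht₀) (hu.continuous_two t₀ ht₀)

theorem toL2_zero {f : ℝ → StrongDual ℝ (W0 s p Ω)} (hT : 0 < T)
    (hu : IsEnergySolution s p Ω T f u₀ u) :
    toL2 (volume.restrict Ω) (u 0) = toL2 (volume.restrict Ω) u₀ := by
  have hle : 𝓝[>] (0 : ℝ) ≤ 𝓝[Icc 0 T] 0 := by
    rw [← nhdsWithin_Ioc_eq_nhdsGT hT]
    exact nhdsWithin_mono _ Ioc_subset_Icc_self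
  have hmem : ∀ᶠ t in 𝓝[>] (0 : ℝ), MemLp (u t) 2 (volume.restrict Ω) :=
    hle (eventually_mem_nhdsWithin.mono fun t ht => hu.memLp_two t ht)
  exact tendsto_nhds_unique ((hu.continuousOn_toL2 0 ⟨le_rfl, hT.le⟩).mono_left hle)
    (tendsto_toL2 hmem hu.memLp_initial hu.initial)

/-- The dissipation inequality `‖u(b)‖₂² - ‖u(a)‖₂² ≤ -c ∫_a^b ‖u(t)‖₂^p dt`. -/
theorem dissipation (hs : 0 < s) (hps : p * s < N) (hq2 : 2 ≤ critExp N s p)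
    (hΩ : IsOpen Ω) (hbd : Bornology.IsBounded Ω) (hV : 0 < volume.real Ω) {S : ℝ}
    (hS : IsSobolevConst N s p S) (hu : IsEnergySolution s p Ω T 0 u₀ u) {a b : ℝ} (ha : 0 < a)
    (hab : a ≤ b) (hb : b ≤ T) :
    ‖toL2 (volume.restrict Ω) (u b)‖ ^ 2 - ‖toL2 (volume.restrict Ω) (u a)‖ ^ 2 ≤
      -(S * volume.real Ω ^ (-(p / 2 - p / critExp N s p)) *
        ∫ t in a..b, (‖toL2 (volume.restrict Ω) (u t)‖ ^ 2) ^ (p / 2)) := by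
  have hp1 : 1 < p := Fact.out
  have hp : 0 < p := by linarith
  obtain ⟨v, hv, hvu⟩ := hu.memLp_W0
  obtain ⟨ξ, hξ, hder, heqn⟩ := hu.equation
  obtain ⟨J, hJ⟩ := W0.exists_toL2 hs hps hq2 hΩ hbd hS
  have hconj : (p / (p - 1)).HolderConjugate p := (Real.HolderConjugate.conjExponent hp1).symm
  have : Fact (1 < p / (p - 1)) := ⟨hconj.lt⟩
  have : (ENNReal.ofReal (p / (p - 1))).HolderConjugate (ENNReal.ofReal p) :=
    hconj.ennrealOfReal
  set U : ℝ → Lp ℝ 2 (volume.restrict Ω) := fun t => toL2 (volume.restrict Ω) (u t)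
  have hU : ContinuousOn U (Icc 0 T) := hu.continuousOn_toL2
  have hJU : ∀ᵐ t ∂(volume.restrict (Ioo 0 T)), J (v t) = U t := by
    filter_upwards [hvu, ae_restrict_mem measurableSet_Ioo] with t ht htm
    refine Lp.ext ((hJ (v t)).1.trans ?_)
    exact EventuallyEq.trans (ae_restrict_of_ae ht)
      (toL2_ae_eq (hu.memLp_two t (Ioo_subset_Icc_self htm))).symm
  have hweak : ∀ w ∈ W0.testSet s p Ω, ∀ φ : ℝ → ℝ, IsTest (Ioo 0 T) φ →
      ∫ t in Ioo 0 T, φ t * ξ t w = -∫ t in Ioo 0 T, deriv φ t * inner ℝ (U t) (J w) := by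
    rintro w ⟨g, hg, hwg, -⟩ φ hφ
    rw [hder φ hφ w g hg hwg]
    congr 1
    refine setIntegral_congr_fun measurableSet_Ioo fun t ht => ?_
    congr 1
    rw [L2.inner_def]
    refine integral_congr_ae ?_
    filter_upwards [toL2_ae_eq (hu.memLp_two t (Ioo_subset_Icc_self ht)), (hJ w).1,
      ae_restrict_of_ae hwg] with x h1 h2 h3
    have h3' : w.fn x = g x := h3
    simp only [U]
    rw [h1, h2, h3']
    simp [mul_comm]
  have henergy := energy_inequality hU ENNReal.ofReal_ne_top hξ hv hJU W0.dense_testSet hweak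
    ha hab hb
  have hsub : Ioo a b ⊆ Ioo 0 T := Ioo_subset_Ioo ha.le hb
  have hid : ∫ t in Ioo a b, ξ t (v t)
      = -∫ t in Ioo a b, 1 / 2 * ‖(W0.incl s p Ω (v t)).2‖ ^ p := by
    -- The cut-off 1_(a,b) u is admissible because test functions need no regularity in time; it
    -- localises the equation to (a,b).
    have h1 := heqn ((Ioo a b).indicator v) (hv.indicator measurableSet_Ioo)
    have e1 : ∫ t in Ioo 0 T, ξ t ((Ioo a b).indicator v t) = ∫ t in Ioo a b, ξ t (v t) := by
      rw [← inter_eq_right.2 hsub, ← setIntegral_indicator measurableSet_Ioo]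
      refine integral_congr_ae (Eventually.of_forall fun t => ?_)
      by_cases ht : t ∈ Ioo a b <;> simp [inter_eq_right.2 hsub, ht]
    have e2 : ∫ t in Ioo 0 T, pForm s p Ω (u t) ((Ioo a b).indicator v t).fn
        = ∫ t in Ioo a b, 1 / 2 * ‖(W0.incl s p Ω (v t)).2‖ ^ p := by
      rw [← inter_eq_right.2 hsub, ← setIntegral_indicator measurableSet_Ioo]
      refine integral_congr_ae ?_
      filter_upwards [hvu] with t htu
      rw [inter_eq_right.2 hsub]
      by_cases ht : t ∈ Ioo a b
      · rw [indicator_of_mem ht, indicator_of_mem ht, W0.pForm_self htu]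
      · rw [indicator_of_notMem ht, indicator_of_notMem ht, W0.pForm_zero]
    rw [e1, e2] at h1
    simp only [Pi.zero_apply, zero_apply, integral_zero] at h1
    linarith
  set c := S * volume.real Ω ^ (-(p / 2 - p / critExp N s p)) with hc
  have hc0 : 0 ≤ c := by have := hS.1; positivity
  -- `c` is the inverse p-th power of the embedding constant, which bounds the L² norm by the
  -- seminorm alone.
  have hpt : ∀ w : W0 s p Ω, c * ‖J w‖ ^ p ≤ ‖(W0.incl s p Ω w).2‖ ^ p := by
    intro w
    have h1 := Real.rpow_le_rpow (norm_nonneg _) (hJ w).2 hp.le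
    rw [Real.mul_rpow (by have := hS.1; positivity) (norm_nonneg _),
      Real.mul_rpow (Real.rpow_nonneg hS.1.le _) (by positivity), ← Real.rpow_mul hS.1.le,
      ← Real.rpow_mul hV.le] at h1
    have h2 := mul_le_mul_of_nonneg_left h1 hc0
    refine h2.trans (le_of_eq ?_)
    rw [← mul_assoc, ← mul_assoc]
    have e1 : S * S ^ (-(1 / p) * p) = 1 := by
      rw [neg_mul, one_div_mul_cancel hp.ne', Real.rpow_neg_one, mul_inv_cancel₀ hS.1.ne']
    have e2 : volume.real Ω ^ (-(p / 2 - p / critExp N s p)) *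
        volume.real Ω ^ ((1 / 2 - 1 / critExp N s p) * p) = 1 := by
      rw [← Real.rpow_add hV, show -(p / 2 - p / critExp N s p)
        + (1 / 2 - 1 / critExp N s p) * p = 0 by ring, Real.rpow_zero]
    calc _ = (S * S ^ (-(1 / p) * p)) * (volume.real Ω ^ (-(p / 2 - p / critExp N s p)) *
        volume.real Ω ^ ((1 / 2 - 1 / critExp N s p) * p)) *
          ‖(W0.incl s p Ω w).2‖ ^ p := by rw [hc]; ring
      _ = _ := by rw [e1, e2, one_mul, one_mul]
  -- Without integrability the Bochner integral of the energy would default to 0 and bound nothing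
  -- from above.
  have hinteg : IntegrableOn (fun t => ‖(W0.incl s p Ω (v t)).2‖ ^ p) (Ioo a b) := by
    have hmem := (((ContinuousLinearMap.snd ℝ _ _).comp (W0.incl s p Ω)).comp_memLp' hv)
    have := hmem.integrable_norm_rpow (by simpa using hp) ENNReal.ofReal_ne_top
    rw [ENNReal.toReal_ofReal hp.le] at this
    exact IntegrableOn.mono_set this hsub
  have hlow : c * ∫ t in a..b, (‖U t‖ ^ 2) ^ (p / 2)
      ≤ ∫ t in Ioo a b, ‖(W0.incl s p Ω (v t)).2‖ ^ p := by
    rw [intervalIntegral.integral_of_le hab, integral_Ioc_eq_integral_Ioo, ← integral_const_mul]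
    refine integral_mono_of_nonneg (Eventually.of_forall fun t => by positivity) hinteg ?_
    filter_upwards [ae_restrict_of_ae_restrict_of_subset hsub hJU] with t ht
    have e : (‖U t‖ ^ 2) ^ (p / 2) = ‖U t‖ ^ p := by
      rw [← Real.rpow_two, ← Real.rpow_mul (norm_nonneg _)]
      congr 1
      ring
    rw [e, ← ht]
    exact hpt (v t)
  rw [hid, integral_const_mul] at henergy
  linarith

/-- Extinction in finite time of energy solutions without source. -/
theorem ae_eq_zero (hp2 : p < 2) (hs : 0 < s) (hps : p * s < N) (hq2 : 2 ≤ critExp N s p)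
    (hΩ : IsOpen Ω) (hbd : Bornology.IsBounded Ω) {S : ℝ}
    (hS : IsSobolevConst N s p S) (hT : 0 < T) (hu : IsEnergySolution s p Ω T 0 u₀ u) {t : ℝ}
    (ht : 2 / ((2 - p) * S) * norm2 Ω u₀ ^ (2 - p)
      * volume.real Ω ^ (p / 2 - p / critExp N s p) ≤ t) (htT : t ≤ T) :
    ∀ᵐ x, u t x = 0 := by
  have hp1 : 1 < p := Fact.out
  have hS0 := hS.1
  have h2p : 0 < 2 - p := by linarith
  have hnorm : norm2 Ω u₀ = ‖toL2 (volume.restrict Ω) (u 0)‖ := by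
    rw [hu.toL2_zero hT, norm_toL2 hu.memLp_initial, norm2]
  have ht0 : 0 ≤ t := by
    refine le_trans ?_ ht
    rw [hnorm]
    positivity
  have htm : t ∈ Icc 0 T := ⟨ht0, htT⟩
  suffices h : ∀ᵐ x ∂(volume.restrict Ω), u t x = 0 by
    rw [← Measure.restrict_univ (μ := (volume : Measure (E N))), ← union_compl_self Ω]
    exact (ae_restrict_union_iff Ω Ωᶜ _).2 ⟨h, hu.exterior t htm⟩
  -- If |Ω| = 0 the power of |Ω| in `c` can default to 0, but then the claim on Ω is void.
  rcases eq_or_lt_of_le (measureReal_nonneg (μ := volume) (s := Ω)) with hV | hV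
  · have h0 : volume Ω = 0 := by
      rcases (ENNReal.toReal_eq_zero_iff _).1 hV.symm with h | h
      · exact h
      · exact absurd h hbd.measure_lt_top.ne
    rw [Measure.restrict_eq_zero.2 h0]
    simp
  set c := S * volume.real Ω ^ (-(p / 2 - p / critExp N s p)) with hc
  have hc0 : 0 < c := by positivity
  -- With θ = 1 - p/2 the exponent 1 - θ is p/2, and y(0)^θ/(cθ) is the asserted extinction time.
  have hy := eq_zero_of_integral_inequality
    (y := fun t => ‖toL2 (volume.restrict Ω) (u t)‖ ^ 2) (c := c) (θ := 1 - p / 2) (T := T) hc0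
    (by linarith) (by linarith) hT.le (hu.continuousOn_toL2.norm.pow 2) (fun _ _ => sq_nonneg _)
    (fun a b ha hab hb => by
      have := hu.dissipation hs hps hq2 hΩ hbd hV hS ha hab hb
      simpa only [sub_sub_cancel] using this) (t := t) ?_ htT
  · have hz : toL2 (volume.restrict Ω) (u t) = 0 := by simpa using hy
    have h1 := toL2_ae_eq (hu.memLp_two t htm)
    rw [hz] at h1
    exact h1.symm.trans (Lp.coeFn_zero _ _ _)
  · refine le_trans (le_of_eq ?_) ht
    rw [← hnorm, ← Real.rpow_two, ← Real.rpow_mul (by rw [hnorm]; positivity), hc,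
      Real.rpow_neg hV.le, show 2 * (1 - p / 2) = 2 - p by ring,
      show 1 - p / 2 = (2 - p) / 2 by ring]
    field_simp

end IsEnergySolution

end FracPLap

theorem theorem5p1 (N : ℕ) (s p : ℝ) [Fact (1 < p)]
    (hs0 : 0 < s) (hs1 : s < 1) (hps : p * s < N)
    (hp : 2 * (N : ℝ) / (N + 2 * s) ≤ p) (hp2 : p < 2) :
    (∃ S : ℝ, FracPLap.IsSobolevConst N s p S) ∧
    ∀ S : ℝ, FracPLap.IsSobolevConst N s p S →
      -- the extinction time as a function of `|Ω|` and `‖u₀‖₂`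
      ∃ Tstar : ℝ → ℝ → ℝ,
        (∀ V M : ℝ, 0 ≤ V → 0 ≤ M → 0 ≤ Tstar V M ∧
          Tstar V M ≤ 2 / ((2 - p) * S) * M ^ (2 - p)
            * V ^ (p / 2 - p / FracPLap.critExp N s p)) ∧
        ∀ Ω : Set (FracPLap.E N), IsOpen Ω → Bornology.IsBounded Ω →
        ∀ u₀ : FracPLap.E N → ℝ, MemLp u₀ 2 (volume.restrict Ω) →
          (∀ T : ℝ, 0 < T → ∀ u : ℝ → FracPLap.E N → ℝ,
            FracPLap.IsEnergySolution s p Ω T 0 u₀ u →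
            ∀ t : ℝ, Tstar (volume.real Ω) (FracPLap.norm2 Ω u₀) ≤ t → t ≤ T →
              ∀ᵐ x, u t x = 0) ∧
          (∀ u : ℝ → FracPLap.E N → ℝ,
            (∀ T : ℝ, 0 < T → FracPLap.IsEnergySolution s p Ω T 0 u₀ u) →
            ∀ t : ℝ, Tstar (volume.real Ω) (FracPLap.norm2 Ω u₀) ≤ t →
              ∀ᵐ x, u t x = 0) := by
  have hp1 : 1 < p := Fact.out
  have hq2 := FracPLap.two_le_critExp hs0 hps hp
  refine ⟨FracPLap.exists_isSobolevConst hp1 hs0 hps, fun S hS => ?_⟩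
  -- The upper bound itself serves as the extinction time.
  refine ⟨fun V M => 2 / ((2 - p) * S) * M ^ (2 - p)
    * V ^ (p / 2 - p / FracPLap.critExp N s p), fun V M hV hM => ⟨?_, le_rfl⟩, ?_⟩
  · have h1 : 0 < 2 - p := by linarith
    have h2 := hS.1
    positivity
  intro Ω hΩ hbd u₀ _
  refine ⟨fun T hT u hu t ht htT => hu.ae_eq_zero hp2 hs0 hps hq2 hΩ hbd hS hT ht htT,
    fun u hu t ht => ?_⟩
  -- The horizon max(t,1) stays positive even when t = 0.
  exact (hu (max t 1) (by positivity)).ae_eq_zero hp2 hs0 hps hq2 hΩ hbd hS (by positivity) ht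
    (le_max_left _ _)
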